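/- Theorem (Open mapping theorem). Call a topological space \emph{interpretable} if it is regular Hausdorff and an open continuous image of a Čech complete space (a $G_\delta$ subspace of a compact Hausdorff space). Let $M$ be a transitive model (a set or a proper class) of ZFC. For a topological space $\langle X,\tau\rangle$ in the sense of $M$, a \emph{preinterpretation} of $X$ over $M$ is a $T_0$ topological space $\langle\hat X,\hat\tau\rangle$ with maps $\pi\colon X\to\hat X$ and $\pi\colon\tau\to\hat\tau$ such that $x\in O\Leftrightarrow\pi(x)\in\pi(O)$ for all $x\in X$, $O\in\tau$; $\pi$ commutes with finite intersections of open sets and with unions of those families of open sets which belong to $M$; $\pi(\emptyset)=\emptyset$ and $\pi(X)=\hat X$; and $\pi''\tau$ is a basis of $\hat\tau$. A \emph{reduction} of a preinterpretation $\pi_0\colon X\to\hat X_0$ to $\pi_1\colon X\to\hat X_1$ is a map $h\colon\hat X_0\to\hat X_1$ with $\pi_1=h\circ\pi_0$ on $X$ and $h^{-1}\pi_1(O)=\pi_0(O)$ for all $O\in\tau$. An \emph{interpretation} of $X$ is a preinterpretation to which every preinterpretation of $X$ has a reduction. If $M\models f\colon X\to Y$ is a continuous function and $\pi\colon X\to\hat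 X$, $\chi\colon Y\to\hat Y$ are interpretations, an \emph{interpretation} of $f$ is a continuous function $\hat f\colon\hat X\to\hat Y$ with $\hat f(\pi(x))=\chi(f(x))$ for all $x\in X$. Suppose that $M\models$ ``$\langle X,\tau\rangle$ and $\langle Y,\sigma\rangle$ are interpretable spaces and $f\colon X\to Y$ is an open continuous function'', and let $\pi\colon X\to\hat X$ and $\chi\colon Y\to\hat Y$ be interpretations. Then $f$ has exactly one interpretation $\hat f\colon\hat X\to\hat Y$, and 1. $\hat f$ is an open continuous function from $\hat X$ to $\hat Y$; 2. whenever $O\in\tau$ and $P\in\sigma$ are such that $f''O=P$, then $\hat f''\pi(O)=\chi(P)$. In particular, if $f$ is surjective, then $\hat f$ is surjective, so that open continuous surjections are interpreted as open continuous surjections. -/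

import Mathlib

universe u

namespace ModelTop

/-! ### Transitive models of set theory

The universe of sets is Mathlib's `ZFSet`. A model is a class `M : Set ZFSet` (possibly proper)
equipped with the true membership relation. -/

/-- The relation symbols of the language of set theory: one binary symbol. -/
inductive SetRel : ℕ → Type
  | mem : SetRel 2

/-- The first-order language of set theory. -/
def setLanguage : FirstOrder.Language.{0, 0} where
  Functions := fun _ => Empty
  Relations := SetRel

/-- A class of sets as a structure for the language of set theory. -/
instance memStructure (M : Set ZFSet.{u}) : setLanguage.Structure M where
  funMap := fun f => Empty.elim f
  RelMap := fun r => match r with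
    | SetRel.mem => fun v => (v 0).1 ∈ (v 1).1

/-- `(M, ∈)` satisfies the axioms of ZFC. Every axiom is relativized to `M`; the two schemata speak
about all classes which are first-order definable over `(M, ∈)` with parameters from `M`. -/
structure ModelsZFC (M : Set ZFSet.{u}) : Prop where
  extensionality : ∀ a ∈ M, ∀ b ∈ M, (∀ x ∈ M, x ∈ a ↔ x ∈ b) → a = b
  foundation : ∀ a ∈ M, (∃ x ∈ M, x ∈ a) → ∃ x ∈ M, x ∈ a ∧ ∀ y ∈ M, y ∈ a → y ∉ x
  pairing : ∀ a ∈ M, ∀ b ∈ M, ∃ c ∈ M, ∀ x ∈ M, x ∈ c ↔ x = a ∨ x = b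
  union : ∀ a ∈ M, ∃ c ∈ M, ∀ x ∈ M, x ∈ c ↔ ∃ y ∈ M, y ∈ a ∧ x ∈ y
  powerset : ∀ a ∈ M, ∃ c ∈ M, ∀ x ∈ M, x ∈ c ↔ ∀ y ∈ M, y ∈ x → y ∈ a
  infinity : ∃ w ∈ M, (∃ e ∈ M, e ∈ w ∧ ∀ y ∈ M, y ∉ e) ∧
    ∀ x ∈ M, x ∈ w → ∃ s ∈ M, s ∈ w ∧ ∀ y ∈ M, y ∈ s ↔ y ∈ x ∨ y = x
  separation : ∀ D : Set M, (Set.univ : Set M).Definable₁ setLanguage D →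
    ∀ a : M, ∃ c : M, ∀ x : M, x.1 ∈ c.1 ↔ x.1 ∈ a.1 ∧ x ∈ D
  replacement : ∀ R : Set (M × M), (Set.univ : Set M).Definable₂ setLanguage R →
    ∀ a : M, (∀ x : M, x.1 ∈ a.1 → ∀ y z : M, (x, y) ∈ R → (x, z) ∈ R → y = z) →
    ∃ c : M, ∀ y : M, y.1 ∈ c.1 ↔ ∃ x : M, x.1 ∈ a.1 ∧ (x, y) ∈ R
  choice : ∀ a ∈ M, (∀ x ∈ M, x ∈ a → ∃ y ∈ M, y ∈ x) →
    (∀ x ∈ M, ∀ y ∈ M, x ∈ a → y ∈ a → x ≠ y → ∀ z ∈ M, ¬(z ∈ x ∧ z ∈ y)) →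
    ∃ c ∈ M, ∀ x ∈ M, x ∈ a → ∃! y, y ∈ M ∧ y ∈ x ∧ y ∈ c

/-- `M` is a transitive model of ZFC. -/
structure IsTransitiveModel (M : Set ZFSet.{u}) : Prop where
  transitive : ∀ a ∈ M, ∀ x ∈ a, x ∈ M
  zfc : ModelsZFC M

/-! ### Topology inside a transitive model

For each notion, `…In M` is its relativization to `M`: quantifiers over subfamilies, spaces and maps
range over `M` only. Bounded quantifiers, and the notions of subset, function, finite set and natural
number, are absolute for transitive models and are written without relativization. -/

/-- The image `f''A` of a set under a set-theoretic function. -/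
noncomputable def img (f A Y : ZFSet.{u}) : ZFSet.{u} :=
  ZFSet.sep (fun y => ∃ x ∈ A, ZFSet.pair x y ∈ f) Y

/-- The preimage `f⁻¹B` of a set under a set-theoretic function with domain `X`. -/
noncomputable def preimg (f X B : ZFSet.{u}) : ZFSet.{u} :=
  ZFSet.sep (fun x => ∃ y ∈ B, ZFSet.pair x y ∈ f) X

/-- `M ⊨ ⟨X, τ⟩ is a topological space`. -/
structure IsTopSpaceIn (M : Set ZFSet.{u}) (X τ : ZFSet.{u}) : Prop where
  carrier_mem : X ∈ M
  opens_mem : τ ∈ M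
  subset : ∀ O ∈ τ, O ⊆ X
  empty_mem : ∅ ∈ τ
  univ_mem : X ∈ τ
  inter_mem : ∀ O ∈ τ, ∀ P ∈ τ, O ∩ P ∈ τ
  sUnion_mem : ∀ A ∈ M, A ⊆ τ → ZFSet.sUnion A ∈ τ

/-- The Hausdorff property of `⟨X, τ⟩`. -/
def IsHausdorff (X τ : ZFSet.{u}) : Prop :=
  ∀ x ∈ X, ∀ y ∈ X, x ≠ y → ∃ O ∈ τ, ∃ P ∈ τ, x ∈ O ∧ y ∈ P ∧ O ∩ P = ∅

/-- Regularity of `⟨X, τ⟩`: a point `x` and a closed set `X \ O` not containing it can be separated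
by disjoint open sets. -/
def IsRegular (X τ : ZFSet.{u}) : Prop :=
  ∀ O ∈ τ, ∀ x ∈ O, ∃ P ∈ τ, ∃ Q ∈ τ, x ∈ P ∧ X \ O ⊆ Q ∧ P ∩ Q = ∅

/-- `M ⊨ ⟨X, τ⟩ is compact`. -/
def IsCompactIn (M : Set ZFSet.{u}) (X τ : ZFSet.{u}) : Prop :=
  ∀ A ∈ M, A ⊆ τ → ZFSet.sUnion A = X →
    ∃ B ∈ M, B ⊆ A ∧ (B : Set ZFSet.{u}).Finite ∧ ZFSet.sUnion B = X

/-- `M ⊨ G is a Gδ subset of ⟨X, τ⟩`: it is the intersection of a sequence of open sets which is an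
element of `M`. -/
def IsGdeltaIn (M : Set ZFSet.{u}) (X τ G : ZFSet.{u}) : Prop :=
  ∃ g ∈ M, ZFSet.IsFunc ZFSet.omega τ g ∧
    ∀ x, x ∈ G ↔ x ∈ X ∧ ∀ n ∈ ZFSet.omega, ∀ U ∈ τ, ZFSet.pair n U ∈ g → x ∈ U

/-- `M ⊨ f is a continuous function from ⟨X, τ⟩ to ⟨Y, σ⟩`. -/
structure IsContinuousIn (M : Set ZFSet.{u}) (X τ Y σ f : ZFSet.{u}) : Prop where
  mem : f ∈ M
  isFunc : ZFSet.IsFunc X Y f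
  preimg_mem : ∀ P ∈ σ, preimg f X P ∈ τ

/-- Images of open sets under `f : X → Y` are open. -/
def IsOpenFun (τ Y σ f : ZFSet.{u}) : Prop :=
  ∀ O ∈ τ, img f O Y ∈ σ

/-- `f` maps `X` onto `Y`. -/
def IsOnto (X Y f : ZFSet.{u}) : Prop :=
  ∀ y ∈ Y, ∃ x ∈ X, ZFSet.pair x y ∈ f

/-- `M ⊨ e is a topological embedding of ⟨X, τ⟩ into ⟨K, κ⟩`. -/
structure IsEmbeddingIn (M : Set ZFSet.{u}) (X τ K κ e : ZFSet.{u}) : Prop where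
  mem : e ∈ M
  isFunc : ZFSet.IsFunc X K e
  injective : ∀ x ∈ X, ∀ x' ∈ X, ∀ y ∈ K, ZFSet.pair x y ∈ e → ZFSet.pair x' y ∈ e → x = x'
  opens_iff : ∀ O, O ∈ τ ↔ ∃ U ∈ κ, O = preimg e X U

/-- `M ⊨ ⟨X, τ⟩ is Čech complete`, i.e. (homeomorphic to) a Gδ subspace of a compact Hausdorff
space. -/
def IsCechCompleteIn (M : Set ZFSet.{u}) (X τ : ZFSet.{u}) : Prop :=
  IsTopSpaceIn M X τ ∧ ∃ K κ e : ZFSet.{u}, IsTopSpaceIn M K κ ∧ IsHausdorff K κ ∧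
    IsCompactIn M K κ ∧ IsEmbeddingIn M X τ K κ e ∧ IsGdeltaIn M K κ (img e X K)

/-- `M ⊨ ⟨X, τ⟩ is interpretable`, i.e. regular Hausdorff and a continuous open image of a
Čech complete space. -/
def IsInterpretableIn (M : Set ZFSet.{u}) (X τ : ZFSet.{u}) : Prop :=
  IsTopSpaceIn M X τ ∧ IsHausdorff X τ ∧ IsRegular X τ ∧
    ∃ Z ζ p : ZFSet.{u}, IsCechCompleteIn M Z ζ ∧ IsContinuousIn M Z ζ X τ p ∧
      IsOpenFun ζ X τ p ∧ IsOnto Z X p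

/-! ### Interpretations in the universe

The topological spaces of the universe `V = ZFSet.{u}` are, up to isomorphism, the topological spaces
on types in `Type u`. -/

/-- The maps `π` on points and `πo` on open sets form a preinterpretation over `M` of `⟨X, τ⟩` in
the `T₀` space `Xh`. -/
structure IsPreinterpretation (M : Set ZFSet.{u}) (X τ : ZFSet.{u}) (Xh : Type u)
    [TopologicalSpace Xh] (π : X → Xh) (πo : τ → Set Xh) : Prop where
  t0 : T0Space Xh
  mem_iff : ∀ (x : X) (O : τ), x.1 ∈ O.1 ↔ π x ∈ πo O
  inter : ∀ O P Q : τ, Q.1 = O.1 ∩ P.1 → πo Q = πo O ∩ πo P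
  sUnion : ∀ A ∈ M, A ⊆ τ → ∀ O : τ, O.1 = ZFSet.sUnion A →
    πo O = ⋃ P ∈ {P : τ | P.1 ∈ A}, πo P
  empty : ∀ O : τ, O.1 = ∅ → πo O = ∅
  univ : ∀ O : τ, O.1 = X → πo O = Set.univ
  isBasis : TopologicalSpace.IsTopologicalBasis (Set.range πo)

/-- `h` is a reduction of the preinterpretation `(π₀, πo₀)` to `(π₁, πo₁)`. -/
def IsReduction {X τ : ZFSet.{u}} {X₀ X₁ : Type u} (π₀ : X → X₀) (πo₀ : τ → Set X₀)
    (π₁ : X → X₁) (πo₁ : τ → Set X₁) (h : X₀ → X₁) : Prop :=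
  (∀ x, π₁ x = h (π₀ x)) ∧ ∀ O, h ⁻¹' (πo₁ O) = πo₀ O

/-- `(π, πo)` is an interpretation: a preinterpretation to which every preinterpretation reduces. -/
def IsInterpretation (M : Set ZFSet.{u}) (X τ : ZFSet.{u}) (Xh : Type u)
    [TopologicalSpace Xh] (π : X → Xh) (πo : τ → Set Xh) : Prop :=
  IsPreinterpretation M X τ Xh π πo ∧
    ∀ (Z : Type u) [TopologicalSpace Z] (ρ : X → Z) (ρo : τ → Set Z),
      IsPreinterpretation M X τ Z ρ ρo → ∃ h : Z → Xh, IsReduction ρ ρo π πo h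

/-- `fh` is an interpretation of `f : X → Y` with respect to `π` and `χ`. -/
def IsMapInterpretation {X Y : ZFSet.{u}} (f : ZFSet.{u}) {Xh Yh : Type u} [TopologicalSpace Xh]
    [TopologicalSpace Yh] (π : X → Xh) (χ : Y → Yh) (fh : Xh → Yh) : Prop :=
  Continuous fh ∧ ∀ (x : X) (y : Y), ZFSet.pair x.1 y.1 ∈ f → fh (π x) = χ y

end ModelTop

/-! A point of an interpretation leaves a trace on `τ`: the filter of those open sets of `M` whose
interpretations contain it. Such a filter is proper and prime for unions of families in `M`
(`IsPoint`). The set of all these filters is itself a preinterpretation, so the universal property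
makes every one of them the trace of a point (`IsInterpretation.exists_point`), unique by T₀.
Pushing filters forward along `f` then defines the interpretation of `f`. It is continuous, and it
is the only one because the image of `X` is dense and the target is Hausdorff.

Openness reduces to the image formula, and that to a lifting statement (`IsPoint.exists_lift`): if
`G` is a point of `Y` with `f''O ∈ G`, some point of `X` contains `O` and maps to `G`. Write `X` as
the image of a Gδ subspace `Z` of a compact space `K`. Primeness of `G` yields open sets `V n` of
`K`, each well inside the preceding one and the corresponding set of the Gδ sequence, whose images
in `Y` belong to `G`. An ultrafilter on `Z` containing the traces of the `V n` and the preimages of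
the members of `G` converges, by compactness in `M`, to a point `F` of `K` containing the whole Gδ
sequence.

To bring `F` down to `X`, inclusions that `M` knows only on `Z` must be respected by `F`
(`IsPoint.mem_of_inter_gdelta_subset`). A failure would give, in the universe, an infinite branch
through a tree belonging to `M`. Well-foundedness is absolute (`exists_branch_mem_model`), so there
is also a branch in `M`, and a Baire category argument in `M` produces a point of `Z` violating the
inclusion. -/

namespace ModelTop

/-! ### Definability over `M` and closure of `M` under elementary set operations. -/

section Definability

open FirstOrder

variable {M : Set ZFSet.{u}} {ι : Type}

/-- A predicate of finitely many sets is definable over `(M, ∈)` with parameters, as far as its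
arguments from `M` are concerned. -/
class DefPred (M : Set ZFSet.{u}) {ι : Type} (P : (ι → ZFSet.{u}) → Prop) : Prop where
  out : (Set.univ : Set M).Definable setLanguage {v : ι → M | P fun i => (v i).1}

theorem DefPred.congr {P Q : (ι → ZFSet.{u}) → Prop} (h : DefPred M P)
    (hPQ : ∀ v, (∀ i, v i ∈ M) → (Q v ↔ P v)) : DefPred M Q := by
  refine ⟨?_⟩
  convert h.out using 1
  ext v
  exact hPQ _ fun i => (v i).2

instance DefPred.and (P Q : (ι → ZFSet.{u}) → Prop) [hP : DefPred M P] [hQ : DefPred M Q] :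
    DefPred M fun v => P v ∧ Q v :=
  ⟨hP.out.inter hQ.out⟩

instance DefPred.or (P Q : (ι → ZFSet.{u}) → Prop) [hP : DefPred M P] [hQ : DefPred M Q] :
    DefPred M fun v => P v ∨ Q v :=
  ⟨hP.out.union hQ.out⟩

instance DefPred.not (P : (ι → ZFSet.{u}) → Prop) [hP : DefPred M P] :
    DefPred M fun v => ¬ P v :=
  ⟨hP.out.compl⟩

instance DefPred.imp (P Q : (ι → ZFSet.{u}) → Prop) [hP : DefPred M P] [hQ : DefPred M Q] :
    DefPred M fun v => P v → Q v :=
  (inferInstance : DefPred M fun v => ¬ P v ∨ Q v).congr fun _ _ => imp_iff_not_or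

instance DefPred.iff (P Q : (ι → ZFSet.{u}) → Prop) [hP : DefPred M P] [hQ : DefPred M Q] :
    DefPred M fun v => P v ↔ Q v :=
  (inferInstance : DefPred M fun v => (P v → Q v) ∧ (Q v → P v)).congr fun _ _ =>
    iff_iff_implies_and_implies

/-- Quantification over `M`. -/
instance DefPred.exists_mem_model (P : (ι → ZFSet.{u}) → ZFSet.{u} → Prop)
    [hP : DefPred M fun w : ι ⊕ Fin 1 → ZFSet.{u} =>
      P (fun i => w (Sum.inl i)) (w (Sum.inr 0))] :
    DefPred M fun v => ∃ x ∈ M, P v x := by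
  refine ⟨?_⟩
  convert hP.out.image_comp_sumInl_fin 1 using 1
  ext v
  constructor
  · rintro ⟨x, hx, h⟩
    exact ⟨Sum.elim v fun _ => ⟨x, hx⟩, h, rfl⟩
  · rintro ⟨w, h, rfl⟩
    exact ⟨_, (w (Sum.inr 0)).2, h⟩

instance DefPred.forall_mem_model (P : (ι → ZFSet.{u}) → ZFSet.{u} → Prop)
    [hP : DefPred M fun w : ι ⊕ Fin 1 → ZFSet.{u} =>
      P (fun i => w (Sum.inl i)) (w (Sum.inr 0))] :
    DefPred M fun v => ∀ x ∈ M, P v x :=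
  (inferInstance : DefPred M fun v => ¬ ∃ x ∈ M, ¬ P v x).congr fun _ _ => by push Not; rfl

theorem DefPred.reindex {κ : Type} {P : (ι → ZFSet.{u}) → Prop} (hP : DefPred M P) (e : ι → κ) :
    DefPred M fun w : κ → ZFSet.{u} => P fun i => w (e i) :=
  ⟨hP.out.preimage_comp e⟩

/-- Substitution of parameters from `M`. -/
theorem DefPred.subst {κ : Type} {P : (ι ⊕ κ → ZFSet.{u}) → Prop} (hP : DefPred M P)
    (v : ι → ZFSet.{u}) (hv : ∀ i, v i ∈ M) : DefPred M fun w => P (Sum.elim v w) := by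
  obtain ⟨φ, hφ⟩ := Set.definable_iff_exists_formula_sum.1 hP.out
  refine ⟨Set.definable_iff_exists_formula_sum.2 ⟨φ.relabel (Sum.elim Sum.inl
    (Sum.elim (fun i => Sum.inl ⟨⟨v i, hv i⟩, trivial⟩) Sum.inr)), ?_⟩⟩
  ext w
  have h := Set.ext_iff.1 hφ (Sum.elim (fun i => ⟨v i, hv i⟩) w)
  simp only [Set.mem_ofPred_eq] at h ⊢
  rw [Language.Formula.realize_relabel]
  convert h using 2
  · ext i
    cases i <;> rfl
  · ext i
    rcases i with i | i | i <;> rfl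

instance DefPred.mem_var (i j : ι) : DefPred M fun v => v i ∈ v j := by
  refine ⟨Set.definable_iff_exists_formula_sum.2 ⟨Language.Relations.formula₂
    (show setLanguage.Relations 2 from SetRel.mem) (Language.Term.var (Sum.inr i))
    (Language.Term.var (Sum.inr j)), ?_⟩⟩
  ext v
  simp only [Set.mem_ofPred_eq]
  rfl

instance DefPred.eq_var (i j : ι) : DefPred M fun v => v i = v j := by
  refine ⟨Set.definable_iff_exists_formula_sum.2 ⟨Language.Term.equal (Language.Term.var (Sum.inr i))
    (Language.Term.var (Sum.inr j)), ?_⟩⟩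
  ext v
  simp [Subtype.ext_iff]

/-- A function of finitely many sets which maps `M` to `M` and is definable over `M`. -/
class DefTerm (M : Set ZFSet.{u}) {ι : Type} (t : (ι → ZFSet.{u}) → ZFSet.{u}) : Prop where
  mem : ∀ v, (∀ i, v i ∈ M) → t v ∈ M
  graph : DefPred M fun w : ι ⊕ Fin 1 → ZFSet.{u} => w (Sum.inr 0) = t fun i => w (Sum.inl i)

instance DefTerm.var (i : ι) : DefTerm M fun v => v i :=
  ⟨fun _ hv => hv i, inferInstance⟩

/-- Parameters enter through `Fact (c ∈ M)`, so that instance search can assemble the definability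
of a whole formula from its syntax. -/
instance DefTerm.const (c : ZFSet.{u}) [hc : Fact (c ∈ M)] : DefTerm M fun _ : ι → ZFSet.{u} => c :=
  ⟨fun _ _ => hc.out, ((DefPred.eq_var (ι := Fin 1 ⊕ (ι ⊕ Fin 1)) (Sum.inr (Sum.inr 0))
    (Sum.inl 0)).subst (fun _ => c) fun _ => hc.out)⟩

theorem DefTerm.reindex {κ : Type} {t : (ι → ZFSet.{u}) → ZFSet.{u}} (ht : DefTerm M t)
    (e : ι → κ) : DefTerm M fun w : κ → ZFSet.{u} => t fun i => w (e i) :=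
  ⟨fun _ hw => ht.mem _ fun _ => hw _, by
    simpa using ht.graph.reindex (Sum.map e (id : Fin 1 → Fin 1))⟩

instance DefPred.mem (t s : (ι → ZFSet.{u}) → ZFSet.{u}) [ht : DefTerm M t] [hs : DefTerm M s] :
    DefPred M fun v => t v ∈ s v := by
  have h₁ : DefPred M fun w : (ι ⊕ Fin 1) ⊕ Fin 1 → ZFSet.{u} =>
      w (Sum.inl (Sum.inr 0)) = t fun i => w (Sum.inl (Sum.inl i)) := ht.graph.reindex Sum.inl
  have h₂ : DefPred M fun w : (ι ⊕ Fin 1) ⊕ Fin 1 → ZFSet.{u} =>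
      w (Sum.inr 0) = s fun i => w (Sum.inl (Sum.inl i)) := by
    simpa using hs.graph.reindex (Sum.map Sum.inl (id : Fin 1 → Fin 1))
  refine (inferInstance : DefPred M fun v => ∃ x ∈ M, ∃ y ∈ M, x = t v ∧ y = s v ∧ x ∈ y).congr
    fun v hv => ⟨fun h => ⟨_, ht.mem v hv, _, hs.mem v hv, rfl, rfl, h⟩, ?_⟩
  rintro ⟨x, -, y, -, rfl, rfl, h⟩
  exact h

instance DefPred.eq (t s : (ι → ZFSet.{u}) → ZFSet.{u}) [ht : DefTerm M t] [hs : DefTerm M s] :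
    DefPred M fun v => t v = s v := by
  have h₁ : DefPred M fun w : (ι ⊕ Fin 1) → ZFSet.{u} =>
      w (Sum.inr 0) = t fun i => w (Sum.inl i) := ht.graph
  have h₂ : DefPred M fun w : (ι ⊕ Fin 1) → ZFSet.{u} =>
      w (Sum.inr 0) = s fun i => w (Sum.inl i) := hs.graph
  refine (inferInstance : DefPred M fun v => ∃ x ∈ M, x = t v ∧ x = s v).congr
    fun v hv => ⟨fun h => ⟨_, ht.mem v hv, rfl, h⟩, ?_⟩
  rintro ⟨x, -, rfl, h⟩
  exact h

variable [hM : Fact (IsTransitiveModel M)]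

theorem mem_model_of_mem {a x : ZFSet.{u}} (ha : a ∈ M) (hx : x ∈ a) : x ∈ M :=
  hM.out.transitive a ha x hx

instance DefPred.exists_mem (t : (ι → ZFSet.{u}) → ZFSet.{u})
    (P : (ι → ZFSet.{u}) → ZFSet.{u} → Prop) [ht : DefTerm M t]
    [hP : DefPred M fun w : ι ⊕ Fin 1 → ZFSet.{u} =>
      P (fun i => w (Sum.inl i)) (w (Sum.inr 0))] :
    DefPred M fun v => ∃ x ∈ t v, P v x := by
  have := ht.reindex (Sum.inl : ι → ι ⊕ Fin 1)
  refine (inferInstance : DefPred M fun v => ∃ x ∈ M, x ∈ t v ∧ P v x).congr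
    fun v hv => ⟨fun ⟨x, hx, h⟩ => ⟨x, mem_model_of_mem (ht.mem v hv) hx, hx, h⟩,
      fun ⟨x, _, hx, h⟩ => ⟨x, hx, h⟩⟩

instance DefPred.forall_mem (t : (ι → ZFSet.{u}) → ZFSet.{u})
    (P : (ι → ZFSet.{u}) → ZFSet.{u} → Prop) [ht : DefTerm M t]
    [hP : DefPred M fun w : ι ⊕ Fin 1 → ZFSet.{u} =>
      P (fun i => w (Sum.inl i)) (w (Sum.inr 0))] :
    DefPred M fun v => ∀ x ∈ t v, P v x :=
  (inferInstance : DefPred M fun v => ¬ ∃ x ∈ t v, ¬ P v x).congr fun _ _ => by push Not; rfl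

instance DefPred.subset (t s : (ι → ZFSet.{u}) → ZFSet.{u}) [ht : DefTerm M t]
    [hs : DefTerm M s] : DefPred M fun v => t v ⊆ s v := by
  have := hs.reindex (Sum.inl : ι → ι ⊕ Fin 1)
  exact (inferInstance : DefPred M fun v => ∀ x ∈ t v, x ∈ s v).congr fun _ _ => Iff.rfl

/-- Recognizing definable functions by the elements of their values. -/
theorem DefTerm.of_mem {t : (ι → ZFSet.{u}) → ZFSet.{u}} (h : ∀ v, (∀ i, v i ∈ M) → t v ∈ M)
    (ht : DefPred M fun w : ι ⊕ Fin 1 → ZFSet.{u} => w (Sum.inr 0) ∈ t fun i => w (Sum.inl i)) :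
    DefTerm M t := by
  refine ⟨h, ?_⟩
  have h₁ : DefPred M fun w : (ι ⊕ Fin 1) ⊕ Fin 1 → ZFSet.{u} =>
      w (Sum.inr 0) ∈ t fun i => w (Sum.inl (Sum.inl i)) := by
    simpa using ht.reindex (Sum.map Sum.inl (id : Fin 1 → Fin 1))
  refine (inferInstance : DefPred M fun w : ι ⊕ Fin 1 → ZFSet.{u} =>
    ∀ z ∈ M, z ∈ w (Sum.inr 0) ↔ z ∈ t fun i => w (Sum.inl i)).congr fun w hw =>
      ⟨fun e z _ => by rw [e], fun e => ?_⟩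
  ext z
  exact ⟨fun hz => (e z (mem_model_of_mem (hw _) hz)).1 hz,
    fun hz => (e z (mem_model_of_mem (h _ fun i => hw _) hz)).2 hz⟩

theorem sep_mem_model_of_definable {a : ZFSet.{u}} (ha : a ∈ M) {P : ZFSet.{u} → Prop}
    (hP : DefPred M fun v : Fin 1 → ZFSet.{u} => P (v 0)) : ZFSet.sep P a ∈ M := by
  obtain ⟨c, hc⟩ := hM.out.zfc.separation {x : M | P x.1} hP.out ⟨a, ha⟩
  convert c.2
  ext x
  rw [ZFSet.mem_sep]
  constructor
  · rintro ⟨h₁, h₂⟩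
    exact (hc ⟨x, mem_model_of_mem ha h₁⟩).2 ⟨h₁, h₂⟩
  · intro h
    exact (hc ⟨x, mem_model_of_mem c.2 h⟩).1 h

theorem sep_mem_model {a : ZFSet.{u}} (ha : a ∈ M) (P : ZFSet.{u} → Prop)
    [hP : DefPred M fun v : Fin 1 → ZFSet.{u} => P (v 0)] : ZFSet.sep P a ∈ M :=
  sep_mem_model_of_definable ha hP

instance DefTerm.sep (t : (ι → ZFSet.{u}) → ZFSet.{u}) (P : (ι → ZFSet.{u}) → ZFSet.{u} → Prop)
    [ht : DefTerm M t] [hP : DefPred M fun w : ι ⊕ Fin 1 → ZFSet.{u} =>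
      P (fun i => w (Sum.inl i)) (w (Sum.inr 0))] : DefTerm M fun v => ZFSet.sep (P v) (t v) := by
  refine DefTerm.of_mem (fun v hv => sep_mem_model_of_definable (ht.mem v hv) (hP.subst v hv)) ?_
  have := ht.reindex (Sum.inl : ι → ι ⊕ Fin 1)
  simp only [ZFSet.mem_sep]
  infer_instance

theorem pair_set_mem_model {a b : ZFSet.{u}} (ha : a ∈ M) (hb : b ∈ M) :
    ({a, b} : ZFSet.{u}) ∈ M := by
  obtain ⟨c, hc, h⟩ := hM.out.zfc.pairing a ha b hb
  convert hc
  ext x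
  rw [ZFSet.mem_pair]
  constructor
  · rintro (rfl | rfl)
    · exact (h x ha).2 (Or.inl rfl)
    · exact (h x hb).2 (Or.inr rfl)
  · intro hx
    exact (h x (mem_model_of_mem hc hx)).1 hx

theorem sUnion_mem_model {a : ZFSet.{u}} (ha : a ∈ M) : (ZFSet.sUnion a : ZFSet.{u}) ∈ M := by
  obtain ⟨c, hc, h⟩ := hM.out.zfc.union a ha
  convert hc
  ext x
  rw [ZFSet.mem_sUnion]
  constructor
  · rintro ⟨y, hy, hx⟩
    have hyM := mem_model_of_mem ha hy
    exact (h x (mem_model_of_mem hyM hx)).2 ⟨y, hyM, hy, hx⟩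
  · intro hx
    obtain ⟨y, -, hy, hxy⟩ := (h x (mem_model_of_mem hc hx)).1 hx
    exact ⟨y, hy, hxy⟩

theorem singleton_mem_model {a : ZFSet.{u}} (ha : a ∈ M) : ({a} : ZFSet.{u}) ∈ M := by
  rw [← ZFSet.pair_eq_singleton]
  exact pair_set_mem_model ha ha

theorem union_mem_model {a b : ZFSet.{u}} (ha : a ∈ M) (hb : b ∈ M) : a ∪ b ∈ M := by
  rw [← ZFSet.sUnion_pair]
  exact sUnion_mem_model (pair_set_mem_model ha hb)

theorem insert_mem_model {a b : ZFSet.{u}} (ha : a ∈ M) (hb : b ∈ M) :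
    (insert a b : ZFSet.{u}) ∈ M := by
  rw [ZFSet.insert_eq]
  exact union_mem_model (singleton_mem_model ha) hb

theorem pair_mem_model {a b : ZFSet.{u}} (ha : a ∈ M) (hb : b ∈ M) : ZFSet.pair a b ∈ M :=
  pair_set_mem_model (singleton_mem_model ha) (pair_set_mem_model ha hb)

instance DefTerm.insert (t s : (ι → ZFSet.{u}) → ZFSet.{u}) [ht : DefTerm M t]
    [hs : DefTerm M s] : DefTerm M fun v => (insert (t v) (s v) : ZFSet.{u}) := by
  refine DefTerm.of_mem (fun v hv => insert_mem_model (ht.mem v hv) (hs.mem v hv)) ?_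
  have := ht.reindex (Sum.inl : ι → ι ⊕ Fin 1)
  have := hs.reindex (Sum.inl : ι → ι ⊕ Fin 1)
  simp only [ZFSet.mem_insert_iff]
  infer_instance

instance DefTerm.singleton (t : (ι → ZFSet.{u}) → ZFSet.{u}) [ht : DefTerm M t] :
    DefTerm M fun v => ({t v} : ZFSet.{u}) := by
  refine DefTerm.of_mem (fun v hv => singleton_mem_model (ht.mem v hv)) ?_
  have := ht.reindex (Sum.inl : ι → ι ⊕ Fin 1)
  simp only [ZFSet.mem_singleton]
  infer_instance

instance DefTerm.pair (t s : (ι → ZFSet.{u}) → ZFSet.{u}) [ht : DefTerm M t]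
    [hs : DefTerm M s] : DefTerm M fun v => ZFSet.pair (t v) (s v) :=
  inferInstanceAs (DefTerm M fun v => ({{t v}, {t v, s v}} : ZFSet.{u}))

instance DefTerm.union (t s : (ι → ZFSet.{u}) → ZFSet.{u}) [ht : DefTerm M t]
    [hs : DefTerm M s] : DefTerm M fun v => t v ∪ s v := by
  refine DefTerm.of_mem (fun v hv => union_mem_model (ht.mem v hv) (hs.mem v hv)) ?_
  have := ht.reindex (Sum.inl : ι → ι ⊕ Fin 1)
  have := hs.reindex (Sum.inl : ι → ι ⊕ Fin 1)
  simp only [ZFSet.mem_union]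
  infer_instance

instance DefTerm.inter (t s : (ι → ZFSet.{u}) → ZFSet.{u}) [ht : DefTerm M t]
    [hs : DefTerm M s] : DefTerm M fun v => t v ∩ s v := by
  have := hs.reindex (Sum.inl : ι → ι ⊕ Fin 1)
  simp only [← ZFSet.sep_mem]
  infer_instance

instance DefTerm.preimg (f X B : (ι → ZFSet.{u}) → ZFSet.{u}) [hf : DefTerm M f]
    [hX : DefTerm M X] [hB : DefTerm M B] : DefTerm M fun v => preimg (f v) (X v) (B v) := by
  have := hB.reindex (Sum.inl : ι → ι ⊕ Fin 1)
  have := hf.reindex (fun i => (Sum.inl (Sum.inl i) : (ι ⊕ Fin 1) ⊕ Fin 1))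
  unfold ModelTop.preimg
  infer_instance

/-- Replacement for functions of sets. -/
theorem exists_image_mem_model {a : ZFSet.{u}} (ha : a ∈ M) (R : ZFSet.{u} → ZFSet.{u} → Prop)
    [hR : DefPred M fun v : Fin 2 → ZFSet.{u} => R (v 0) (v 1)]
    (hu : ∀ x ∈ a, ∀ y ∈ M, ∀ z ∈ M, R x y → R x z → y = z) :
    ∃ c ∈ M, ∀ y, y ∈ c ↔ y ∈ M ∧ ∃ x ∈ a, R x y := by
  obtain ⟨c, hc⟩ := hM.out.zfc.replacement {p : M × M | R p.1.1 p.2.1} hR.out ⟨a, ha⟩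
    fun x hx y z hy hz => Subtype.ext (hu x.1 hx y.1 y.2 z.1 z.2 hy hz)
  refine ⟨c.1, c.2, fun y => ⟨fun h => ?_, ?_⟩⟩
  · have hy := mem_model_of_mem c.2 h
    obtain ⟨x, hx, hxy⟩ := (hc ⟨y, hy⟩).1 h
    exact ⟨hy, x.1, hx, hxy⟩
  · rintro ⟨hy, x, hx, hxy⟩
    exact (hc ⟨y, hy⟩).2 ⟨⟨x, mem_model_of_mem ha hx⟩, hx, hxy⟩

/-- The power set of `M`. -/
theorem exists_powerset_mem_model {a : ZFSet.{u}} (ha : a ∈ M) :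
    ∃ c ∈ M, ∀ x, x ∈ c ↔ x ∈ M ∧ x ⊆ a := by
  obtain ⟨c, hc, h⟩ := hM.out.zfc.powerset a ha
  refine ⟨c, hc, fun x => ⟨fun hx => ?_, fun ⟨hx, hs⟩ => (h x hx).2 fun y _ hy => hs hy⟩⟩
  have hxM := mem_model_of_mem hc hx
  exact ⟨hxM, fun y hy => (h x hxM).1 hx y (mem_model_of_mem hxM hy) hy⟩

theorem prod_mem_model {a b : ZFSet.{u}} (ha : a ∈ M) (hb : b ∈ M) : ZFSet.prod a b ∈ M := by
  -- Kuratowski pairs lie in the double power set of the union, from which the product is then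
  -- separated.
  obtain ⟨c, hc, hc'⟩ := exists_powerset_mem_model (union_mem_model ha hb)
  obtain ⟨d, hd, hd'⟩ := exists_powerset_mem_model hc
  have : Fact (a ∈ M) := ⟨ha⟩
  have : Fact (b ∈ M) := ⟨hb⟩
  convert sep_mem_model hd fun p => ∃ x ∈ a, ∃ y ∈ b, p = ZFSet.pair x y using 1
  ext p
  rw [ZFSet.mem_prod, ZFSet.mem_sep, iff_and_self]
  rintro ⟨x, hx, y, hy, rfl⟩
  have hxM := mem_model_of_mem ha hx
  have hyM := mem_model_of_mem hb hy
  refine (hd' _).2 ⟨pair_mem_model hxM hyM, fun z hz => (hc' z).2 ?_⟩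
  rcases ZFSet.mem_pair.1 hz with rfl | rfl
  · refine ⟨singleton_mem_model hxM, fun w hw => ?_⟩
    rw [ZFSet.mem_singleton.1 hw]
    exact ZFSet.mem_union.2 (Or.inl hx)
  · refine ⟨pair_set_mem_model hxM hyM, fun w hw => ?_⟩
    rcases ZFSet.mem_pair.1 hw with rfl | rfl
    · exact ZFSet.mem_union.2 (Or.inl hx)
    · exact ZFSet.mem_union.2 (Or.inr hy)

end Definability

/-! ### Absoluteness of well-foundedness. -/

section Wellfoundedness

variable {M : Set ZFSet.{u}} [hM : Fact (IsTransitiveModel M)]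

theorem mem_model_of_pair_mem {a b r : ZFSet.{u}} (hr : r ∈ M) (h : ZFSet.pair a b ∈ r) :
    a ∈ M ∧ b ∈ M := by
  have h₁ : ({a, b} : ZFSet.{u}) ∈ M :=
    mem_model_of_mem (mem_model_of_mem hr h) (ZFSet.mem_pair.2 (Or.inr rfl))
  exact ⟨mem_model_of_mem h₁ (ZFSet.mem_pair.2 (Or.inl rfl)),
    mem_model_of_mem h₁ (ZFSet.mem_pair.2 (Or.inr rfl))⟩

/-- `r` is part of the collapsing map of the relation `E`, in which the points related to `b` lie
below `b`. -/
def IsCollapse (M : Set ZFSet.{u}) (E r : ZFSet.{u}) : Prop :=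
  ∀ b ∈ M, ∀ w ∈ M, ZFSet.pair b w ∈ r →
    (∀ v ∈ M, v ∈ w ↔ ∃ c ∈ M, ZFSet.pair b c ∈ E ∧ ZFSet.pair c v ∈ r) ∧
      ∀ c ∈ M, ZFSet.pair b c ∈ E → ∃ v ∈ M, ZFSet.pair c v ∈ r

/-- The collapsing map of `E` is defined at `b`, with value `w`. -/
def CollapsesTo (M : Set ZFSet.{u}) (E b w : ZFSet.{u}) : Prop :=
  ∃ r ∈ M, IsCollapse M E r ∧ ZFSet.pair b w ∈ r

instance CollapsesTo.definable {ι : Type} (E : ZFSet.{u}) [Fact (E ∈ M)]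
    (t s : (ι → ZFSet.{u}) → ZFSet.{u}) [ht : DefTerm M t] [hs : DefTerm M s] :
    DefPred M fun v => CollapsesTo M E (t v) (s v) := by
  have := ht.reindex (Sum.inl : ι → ι ⊕ Fin 1)
  have := hs.reindex (Sum.inl : ι → ι ⊕ Fin 1)
  unfold CollapsesTo IsCollapse
  infer_instance

theorem CollapsesTo.mem_model {E b w : ZFSet.{u}} (h : CollapsesTo M E b w) : b ∈ M ∧ w ∈ M :=
  let ⟨_, hr, _, hp⟩ := h
  mem_model_of_pair_mem hr hp

/-- Since `E` need not be well-founded, the induction runs over the value `w` in the true membership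
relation. -/
theorem CollapsesTo.unique {E w : ZFSet.{u}} :
    ∀ {b w' : ZFSet.{u}}, CollapsesTo M E b w → CollapsesTo M E b w' → w = w' := by
  induction w using ZFSet.inductionOn with
  | _ w ih =>
    rintro b w' ⟨r, hr, hc, hp⟩ ⟨r', hr', hc', hp'⟩
    obtain ⟨hb, hw⟩ := mem_model_of_pair_mem hr hp
    have hw' := (mem_model_of_pair_mem hr' hp').2
    obtain ⟨h₁, h₂⟩ := hc b hb w hw hp
    obtain ⟨h₁', h₂'⟩ := hc' b hb w' hw' hp'
    ext v
    constructor
    · intro hv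
      have hvM := mem_model_of_mem hw hv
      obtain ⟨c, hcM, hbc, hcv⟩ := (h₁ v hvM).1 hv
      obtain ⟨v', -, hcv'⟩ := h₂' c hcM hbc
      obtain rfl : v = v' := ih v hv ⟨r, hr, hc, hcv⟩ ⟨r', hr', hc', hcv'⟩
      exact (h₁' v hvM).2 ⟨c, hcM, hbc, hcv'⟩
    · intro hv
      obtain ⟨c, hcM, hbc, hcv⟩ := (h₁' v (mem_model_of_mem hw' hv)).1 hv
      obtain ⟨v', hv'M, hcv'⟩ := h₂ c hcM hbc
      have hv' := (h₁ v' hv'M).2 ⟨c, hcM, hbc, hcv'⟩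
      obtain rfl : v' = v := ih v' hv' ⟨r, hr, hc, hcv'⟩ ⟨r', hr', hc', hcv⟩
      exact hv'

/-- The values along a branch would form an infinite descending `∈`-chain. -/
theorem CollapsesTo.no_branch {E : ZFSet.{u}} (hE : E ∈ M) {w : ZFSet.{u}} :
    ∀ {a : ℕ → ZFSet.{u}}, (∀ n, ZFSet.pair (a n) (a (n + 1)) ∈ E) →
      ¬ CollapsesTo M E (a 0) w := by
  induction w using ZFSet.inductionOn with
  | _ w ih =>
    rintro a ha ⟨r, hr, hc, hp⟩
    obtain ⟨hb, hw⟩ := mem_model_of_pair_mem hr hp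
    obtain ⟨h₁, h₂⟩ := hc _ hb w hw hp
    have h1 := (mem_model_of_pair_mem hE (ha 0)).2
    obtain ⟨v, hv, hcv⟩ := h₂ _ h1 (ha 0)
    exact ih v ((h₁ v hv).2 ⟨_, h1, ha 0, hcv⟩) (a := fun n => a (n + 1)) (fun n => ha (n + 1))
      ⟨r, hr, hc, hcv⟩

/-- Replacement in `M` collects all existing values into one map `r` and those at the successors of
`b` into a set `U`; adding the pair `(b, U)` to `r` extends the collapse to `b`. Arguing by
contradiction ensures that `r` has no value at `b` beforehand. -/
theorem exists_collapsesTo {N E b : ZFSet.{u}} (hN : N ∈ M) (hE : E ∈ M)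
    (hEN : E ⊆ ZFSet.prod N N) (hb : b ∈ M)
    (h : ∀ c, ZFSet.pair b c ∈ E → ∃ w, CollapsesTo M E c w) : ∃ w, CollapsesTo M E b w := by
  by_contra hcon
  push Not at hcon
  have : Fact (E ∈ M) := ⟨hE⟩
  have : Fact (b ∈ M) := ⟨hb⟩
  obtain ⟨r, hr, hr'⟩ := exists_image_mem_model hN
    (fun c p => ∃ w ∈ M, CollapsesTo M E c w ∧ p = ZFSet.pair c w) (by
      rintro x - y - z - ⟨w, -, hw, rfl⟩ ⟨w', -, hw', rfl⟩
      rw [hw.unique hw'])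
  have hrpair : ∀ c v, ZFSet.pair c v ∈ r ↔ c ∈ N ∧ CollapsesTo M E c v := by
    intro c v
    rw [hr']
    constructor
    · rintro ⟨-, c', hc', w, -, hw, hp⟩
      obtain ⟨rfl, rfl⟩ := ZFSet.pair_inj.1 hp
      exact ⟨hc', hw⟩
    · rintro ⟨hc, hv⟩
      have hM := hv.mem_model
      exact ⟨pair_mem_model hM.1 hM.2, c, hc, v, hM.2, hv, rfl⟩
  obtain ⟨U, hU, hU'⟩ := exists_image_mem_model
    (sep_mem_model hN fun c => ZFSet.pair b c ∈ E) (fun c w => CollapsesTo M E c w)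
    fun x _ y _ z _ hy hz => hy.unique hz
  refine hcon U ⟨insert (ZFSet.pair b U) r, insert_mem_model (pair_mem_model hb hU) hr, ?_,
    ZFSet.mem_insert _ _⟩
  have hEN' : ∀ b c, ZFSet.pair b c ∈ E → c ∈ N := fun b c hbc =>
    (ZFSet.pair_mem_prod.1 (hEN hbc)).2
  intro b' hb' w hw hp
  rcases ZFSet.mem_insert_iff.1 hp with hp | hp
  · obtain ⟨rfl, rfl⟩ := ZFSet.pair_inj.1 hp
    refine ⟨fun v hv => ?_, fun c hc hbc => ?_⟩
    · rw [hU']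
      constructor
      · rintro ⟨-, c, hc, hcv⟩
        rw [ZFSet.mem_sep] at hc
        exact ⟨c, hcv.mem_model.1, hc.2, ZFSet.mem_insert_of_mem _ ((hrpair c v).2 ⟨hc.1, hcv⟩)⟩
      · rintro ⟨c, hc, hbc, hcv⟩
        refine ⟨hv, c, ZFSet.mem_sep.2 ⟨hEN' _ _ hbc, hbc⟩, ?_⟩
        rcases ZFSet.mem_insert_iff.1 hcv with hcv | hcv
        · obtain ⟨rfl, rfl⟩ := ZFSet.pair_inj.1 hcv
          obtain ⟨w, hw⟩ := h _ hbc
          exact absurd hw (hcon w)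
        · exact ((hrpair c v).1 hcv).2
    · obtain ⟨v, hv⟩ := h c hbc
      exact ⟨v, hv.mem_model.2, ZFSet.mem_insert_of_mem _ ((hrpair c v).2 ⟨hEN' _ _ hbc, hv⟩)⟩
  · obtain ⟨r₀, hr₀, hc₀, hp₀⟩ := ((hrpair b' w).1 hp).2
    obtain ⟨h₁, h₂⟩ := hc₀ b' hb' w hw hp₀
    refine ⟨fun v hv => ?_, fun c hc hbc => ?_⟩
    · rw [h₁ v hv]
      constructor
      · rintro ⟨c, hc, hbc, hcv⟩
        exact ⟨c, hc, hbc, ZFSet.mem_insert_of_mem _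
          ((hrpair c v).2 ⟨hEN' _ _ hbc, r₀, hr₀, hc₀, hcv⟩)⟩
      · rintro ⟨c, hc, hbc, hcv⟩
        obtain ⟨v', -, hcv'⟩ := h₂ c hc hbc
        have hv' : CollapsesTo M E c v' := ⟨r₀, hr₀, hc₀, hcv'⟩
        refine ⟨c, hc, hbc, ?_⟩
        rcases ZFSet.mem_insert_iff.1 hcv with hcv | hcv
        · obtain ⟨rfl, rfl⟩ := ZFSet.pair_inj.1 hcv
          exact absurd hv' (hcon v')
        · rwa [((hrpair c v).1 hcv).2.unique hv']
    · obtain ⟨v, hv, hcv⟩ := h₂ c hc hbc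
      exact ⟨v, hv, ZFSet.mem_insert_of_mem _
        ((hrpair c v).2 ⟨hEN' _ _ hbc, r₀, hr₀, hc₀, hcv⟩)⟩

/-- If a relation in `M` has an infinite branch, then `M` contains a set without terminal nodes. -/
theorem exists_pruned_of_branch {N E : ZFSet.{u}} (hN : N ∈ M) (hE : E ∈ M)
    (hEN : E ⊆ ZFSet.prod N N) {a : ℕ → ZFSet.{u}}
    (ha : ∀ n, ZFSet.pair (a n) (a (n + 1)) ∈ E) :
    ∃ B ∈ M, a 0 ∈ B ∧ ∀ b ∈ B, ∃ c ∈ B, ZFSet.pair b c ∈ E := by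
  have : Fact (E ∈ M) := ⟨hE⟩
  -- The nodes without a collapse value: if all successors of a node had values, so would the node.
  refine ⟨_, sep_mem_model hN fun b => ¬ ∃ w ∈ M, CollapsesTo M E b w, ?_, fun b hb => ?_⟩
  · rw [ZFSet.mem_sep]
    exact ⟨(ZFSet.pair_mem_prod.1 (hEN (ha 0))).1, fun ⟨w, _, hw⟩ =>
      CollapsesTo.no_branch hE ha hw⟩
  · rw [ZFSet.mem_sep] at hb
    by_contra hcon
    push Not at hcon
    obtain ⟨w, hw⟩ := exists_collapsesTo hN hE hEN (mem_model_of_mem hN hb.1) fun c hbc => by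
      by_contra hc
      exact hcon c (ZFSet.mem_sep.2 ⟨(ZFSet.pair_mem_prod.1 (hEN hbc)).2,
        fun w _ hw => hc ⟨w, hw⟩⟩) hbc
    exact hb.2 ⟨w, hw.mem_model.2, hw⟩

/-- The axiom of choice in `M` selects successors. -/
theorem exists_successor_selection {E B : ZFSet.{u}} (hE : E ∈ M) (hB : B ∈ M)
    (h : ∀ b ∈ B, ∃ c ∈ B, ZFSet.pair b c ∈ E) :
    ∃ t ∈ M, t ⊆ E ∧ (∀ b ∈ B, ∃ c ∈ B, ZFSet.pair b c ∈ t) ∧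
      ∀ b ∈ B, ∀ c ∈ B, ∀ c' ∈ B, ZFSet.pair b c ∈ t → ZFSet.pair b c' ∈ t → c = c' := by
  have : Fact (E ∈ M) := ⟨hE⟩
  have : Fact (B ∈ M) := ⟨hB⟩
  obtain ⟨Q, hQ, hQ'⟩ := exists_powerset_mem_model hE
  -- Choice is available for disjoint families. The sets of edges leaving the various nodes are
  -- disjoint, whereas the sets of successors need not be.
  have hF := sep_mem_model hQ fun S =>
    ∃ b ∈ B, ∀ p ∈ E, p ∈ S ↔ ∃ c ∈ B, p = ZFSet.pair b c
  set F := ZFSet.sep (fun S => ∃ b ∈ B, ∀ p ∈ E, p ∈ S ↔ ∃ c ∈ B, p = ZFSet.pair b c) Q with hFdef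
  have hF' : ∀ S ∈ F, S ⊆ E ∧ ∃ b ∈ B, ∀ p ∈ E, p ∈ S ↔ ∃ c ∈ B, p = ZFSet.pair b c := by
    intro S hS
    rw [hFdef, ZFSet.mem_sep] at hS
    exact ⟨((hQ' S).1 hS.1).2, hS.2⟩
  have hFb : ∀ b ∈ B, ZFSet.sep (fun p => ∃ c ∈ B, p = ZFSet.pair b c) E ∈ F := by
    intro b hb
    have : Fact (b ∈ M) := ⟨mem_model_of_mem hB hb⟩
    rw [hFdef, ZFSet.mem_sep, hQ']
    refine ⟨⟨sep_mem_model hE _, ZFSet.sep_subset⟩, b, hb, fun p hp => ?_⟩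
    rw [ZFSet.mem_sep, and_iff_right hp]
  obtain ⟨t, ht, ht'⟩ := hM.out.zfc.choice F hF (by
    intro S hSM hS
    obtain ⟨hSE, b, hb, hSb⟩ := hF' S hS
    obtain ⟨c, hc, hbc⟩ := h b hb
    exact ⟨_, mem_model_of_mem hE hbc, (hSb _ hbc).2 ⟨c, hc, rfl⟩⟩) (by
    rintro S - S' - hS hS' hne z - ⟨hz, hz'⟩
    obtain ⟨hSE, b, hb, hSb⟩ := hF' S hS
    obtain ⟨hSE', b', hb', hSb'⟩ := hF' S' hS'
    obtain ⟨c, hc, rfl⟩ := (hSb z (hSE hz)).1 hz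
    obtain ⟨c', hc', hp⟩ := (hSb' _ (hSE hz)).1 hz'
    obtain ⟨rfl, rfl⟩ := ZFSet.pair_inj.1 hp
    refine hne ?_
    ext p
    constructor
    · intro hp
      exact (hSb' p (hSE hp)).2 ((hSb p (hSE hp)).1 hp)
    · intro hp
      exact (hSb p (hSE' hp)).2 ((hSb' p (hSE' hp)).1 hp))
  have : Fact (t ∈ M) := ⟨ht⟩
  refine ⟨_, sep_mem_model hE fun p => p ∈ t, ZFSet.sep_subset, fun b hb => ?_,
    fun b hb c hc c' hc' h₁ h₂ => ?_⟩
  · obtain ⟨p, ⟨-, hp, hpt⟩, -⟩ := ht' _ (mem_model_of_mem hF (hFb b hb)) (hFb b hb)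
    rw [ZFSet.mem_sep] at hp
    obtain ⟨hpE, c, hc, rfl⟩ := hp
    exact ⟨c, hc, ZFSet.mem_sep.2 ⟨hpE, hpt⟩⟩
  · rw [ZFSet.mem_sep] at h₁ h₂
    have hu := (ht' _ (mem_model_of_mem hF (hFb b hb)) (hFb b hb)).unique
      ⟨mem_model_of_mem hE h₁.1, ZFSet.mem_sep.2 ⟨h₁.1, c, hc, rfl⟩, h₁.2⟩
      ⟨mem_model_of_mem hE h₂.1, ZFSet.mem_sep.2 ⟨h₂.1, c', hc', rfl⟩, h₂.2⟩
    exact (ZFSet.pair_inj.1 hu).2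

/-- Absoluteness of well-foundedness: if a graded relation in `M` has an infinite branch, then it
has an infinite branch whose range belongs to `M`. -/
theorem exists_branch_mem_model {N E : ZFSet.{u}} (hN : N ∈ M) (hE : E ∈ M)
    (hEN : E ⊆ ZFSet.prod N N) (lev : ZFSet.{u} → Ordinal.{u})
    (hlev : ∀ b c, ZFSet.pair b c ∈ E → lev b < lev c) {a : ℕ → ZFSet.{u}}
    (ha : ∀ n, ZFSet.pair (a n) (a (n + 1)) ∈ E) :
    ∃ T ∈ M, ∃ s : ℕ → ZFSet.{u}, (∀ x, x ∈ T ↔ ∃ n, x = s n) ∧ s 0 = a 0 ∧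
      ∀ n, ZFSet.pair (s n) (s (n + 1)) ∈ E := by
  obtain ⟨B, hB, ha0, hBE⟩ := exists_pruned_of_branch hN hE hEN ha
  obtain ⟨t, ht, htE, hex, hu⟩ := exists_successor_selection hE hB hBE
  choose g hgB hgt using hex
  let s : ℕ → {b // b ∈ B} := fun n => Nat.rec ⟨a 0, ha0⟩ (fun _ b => ⟨g b.1 b.2, hgB b.1 b.2⟩) n
  have hs : ∀ n, ZFSet.pair (s n).1 (s (n + 1)).1 ∈ t := fun n => hgt _ _
  obtain ⟨Q, hQ, hQ'⟩ := exists_powerset_mem_model hB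
  have : Fact (Q ∈ M) := ⟨hQ⟩
  have : Fact (t ∈ M) := ⟨ht⟩
  have : Fact (B ∈ M) := ⟨hB⟩
  have hz : a 0 ∈ M := mem_model_of_mem hB ha0
  have : Fact (a 0 ∈ M) := ⟨hz⟩
  -- The recursion for `s` takes place in the universe. Its range is recovered inside `M` as the
  -- least set containing `a 0` and closed under `t`.
  have hT := sep_mem_model hB fun b => ∀ S ∈ Q, a 0 ∈ S →
    (∀ x ∈ S, ∀ y ∈ B, ZFSet.pair x y ∈ t → y ∈ S) → b ∈ S
  set T := ZFSet.sep (fun b => ∀ S ∈ Q, a 0 ∈ S →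
    (∀ x ∈ S, ∀ y ∈ B, ZFSet.pair x y ∈ t → y ∈ S) → b ∈ S) B with hTdef
  have h0T : a 0 ∈ T := ZFSet.mem_sep.2 ⟨ha0, fun S _ h _ => h⟩
  have hTt : ∀ x ∈ T, ∀ y ∈ B, ZFSet.pair x y ∈ t → y ∈ T := fun x hx y hy hxy =>
    ZFSet.mem_sep.2 ⟨hy, fun S hS h0 hcl => hcl x ((ZFSet.mem_sep.1 hx).2 S hS h0 hcl) y hy hxy⟩
  have hrange : ∀ b ∈ T, ∃ n, b = (s n).1 := by
    intro b
    induction hl : lev b using WellFoundedLT.induction generalizing b with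
    | _ l ih =>
      intro hb
      by_contra hcon
      push Not at hcon
      have : Fact (b ∈ M) := ⟨mem_model_of_mem hT hb⟩
      -- If `b` is not some `s n`, deleting it leaves a closed set: a predecessor of `b` has lower
      -- level, hence is some `s n`, and then `b = s (n + 1)`.
      have hS := sep_mem_model hT fun x => x ≠ b
      refine (ZFSet.mem_sep.1 ((ZFSet.mem_sep.1 hb).2 _ ((hQ' _).2 ⟨hS, fun x hx =>
        ZFSet.sep_subset (ZFSet.sep_subset hx)⟩) (ZFSet.mem_sep.2 ⟨h0T, (hcon 0).symm⟩) ?_)).2 rfl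
      intro x hx y hy hxy
      have hxT := (ZFSet.mem_sep.1 hx).1
      refine ZFSet.mem_sep.2 ⟨hTt x hxT y hy hxy, ?_⟩
      rintro rfl
      obtain ⟨n, rfl⟩ := ih _ (hl ▸ hlev _ _ (htE hxy)) x rfl hxT
      exact hcon (n + 1) (hu _ (s n).2 _ hy _ (s (n + 1)).2 hxy (hs n))
  refine ⟨T, hT, fun n => (s n).1, fun x => ⟨hrange x, ?_⟩, rfl, fun n => htE (hs n)⟩
  rintro ⟨n, rfl⟩
  induction n with
  | zero => exact h0T
  | succ n ih => exact hTt _ ih _ (s (n + 1)).2 (hs n)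

end Wellfoundedness

/-! ### Regularity, compactness and points over `M`. -/

section TopologyInModel

variable {M : Set ZFSet.{u}} {X τ : ZFSet.{u}}

/-- The finite von Neumann ordinals. -/
def vonNeumannNat : ℕ → ZFSet.{u}
  | 0 => ∅
  | n + 1 => insert (vonNeumannNat n) (vonNeumannNat n)

theorem mem_omega_iff {x : ZFSet.{u}} : x ∈ ZFSet.omega.{u} ↔ ∃ n, x = vonNeumannNat n := by
  have h : ∀ n, ZFSet.mk (PSet.ofNat n) = vonNeumannNat n := by
    intro n
    induction n with
    | zero => rfl
    | succ n ih => rw [vonNeumannNat, ← ih]; rfl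
  constructor
  · refine Quotient.inductionOn x fun y => ?_
    rintro ⟨n, hn⟩
    exact ⟨n.down, (ZFSet.sound hn).trans (h n.down)⟩
  · rintro ⟨n, rfl⟩
    induction n with
    | zero => exact ZFSet.omega_zero
    | succ n ih => exact ZFSet.omega_succ ih

/-- `P` is well inside `O`: the closure of `P` is contained in `O`. -/
def WellInside (X τ P O : ZFSet.{u}) : Prop :=
  ∃ Q ∈ τ, O ∪ Q = X ∧ P ∩ Q = ∅

theorem WellInside.subset {P O : ZFSet.{u}} (h : WellInside X τ P O) (hP : P ⊆ X) : P ⊆ O := by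
  obtain ⟨Q, -, h₁, h₂⟩ := h
  intro x hx
  have := hP hx
  rw [← h₁, ZFSet.mem_union] at this
  refine this.resolve_right fun hQ => ?_
  exact (ZFSet.eq_empty _).1 h₂ x (ZFSet.mem_inter.2 ⟨hx, hQ⟩)

theorem IsTopSpaceIn.union_mem [Fact (IsTransitiveModel M)] (h : IsTopSpaceIn M X τ)
    {O P : ZFSet.{u}} (hO : O ∈ τ) (hP : P ∈ τ) : O ∪ P ∈ τ := by
  rw [← ZFSet.sUnion_pair]
  refine h.sUnion_mem _ (pair_set_mem_model (mem_model_of_mem h.opens_mem hO)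
    (mem_model_of_mem h.opens_mem hP)) fun x hx => ?_
  rcases ZFSet.mem_pair.1 hx with rfl | rfl <;> assumption

theorem WellInside.mono (h : IsTopSpaceIn M X τ) {P O O' : ZFSet.{u}} (hP : WellInside X τ P O)
    (hO' : O' ∈ τ) (hOO' : O ⊆ O') : WellInside X τ P O' := by
  obtain ⟨Q, hQ, h₁, h₂⟩ := hP
  refine ⟨Q, hQ, ?_, h₂⟩
  ext x
  rw [ZFSet.mem_union]
  constructor
  · rintro (hx | hx)
    exacts [h.subset _ hO' hx, h.subset _ hQ hx]
  · intro hx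
    rw [← h₁, ZFSet.mem_union] at hx
    exact hx.imp_left fun hx => hOO' hx

theorem WellInside.inter [Fact (IsTransitiveModel M)] (h : IsTopSpaceIn M X τ)
    {P O P' O' : ZFSet.{u}} (hP : WellInside X τ P O) (hP' : WellInside X τ P' O') :
    WellInside X τ (P ∩ P') (O ∩ O') := by
  obtain ⟨Q, hQ, h₁, h₂⟩ := hP
  obtain ⟨Q', hQ', h₁', h₂'⟩ := hP'
  refine ⟨Q ∪ Q', h.union_mem hQ hQ', ?_, ?_⟩
  · ext x
    have e := ZFSet.ext_iff.1 h₁ x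
    have e' := ZFSet.ext_iff.1 h₁' x
    simp only [ZFSet.mem_union, ZFSet.mem_inter] at e e' ⊢
    tauto
  · ext x
    have e := ZFSet.ext_iff.1 h₂ x
    have e' := ZFSet.ext_iff.1 h₂' x
    simp only [ZFSet.mem_union, ZFSet.mem_inter, ZFSet.notMem_empty] at e e' ⊢
    tauto

instance WellInside.definable {ι : Type} [Fact (IsTransitiveModel M)] (X τ : ZFSet.{u})
    [Fact (X ∈ M)] [Fact (τ ∈ M)] (t s : (ι → ZFSet.{u}) → ZFSet.{u}) [ht : DefTerm M t]
    [hs : DefTerm M s] [Fact (∅ ∈ M)] : DefPred M fun v => WellInside X τ (t v) (s v) := by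
  have := ht.reindex (Sum.inl : ι → ι ⊕ Fin 1)
  have := hs.reindex (Sum.inl : ι → ι ⊕ Fin 1)
  unfold WellInside
  infer_instance

theorem IsTopSpaceIn.fact_carrier (h : IsTopSpaceIn M X τ) : Fact (X ∈ M) := ⟨h.carrier_mem⟩

theorem IsTopSpaceIn.fact_opens (h : IsTopSpaceIn M X τ) : Fact (τ ∈ M) := ⟨h.opens_mem⟩

theorem IsRegular.exists_wellInside (h : IsTopSpaceIn M X τ) (hr : IsRegular X τ)
    {O x : ZFSet.{u}} (hO : O ∈ τ) (hx : x ∈ O) : ∃ P ∈ τ, x ∈ P ∧ WellInside X τ P O := by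
  obtain ⟨P, hP, Q, hQ, hxP, hXQ, hPQ⟩ := hr O hO x hx
  refine ⟨P, hP, hxP, Q, hQ, ?_, hPQ⟩
  ext y
  rw [ZFSet.mem_union]
  constructor
  · rintro (hy | hy)
    exacts [h.subset _ hO hy, h.subset _ hQ hy]
  · intro hy
    by_cases hyO : y ∈ O
    · exact Or.inl hyO
    · exact Or.inr (hXQ (ZFSet.mem_sdiff.2 ⟨hy, hyO⟩))

variable [hM : Fact (IsTransitiveModel M)]

theorem IsTopSpaceIn.fact_empty (h : IsTopSpaceIn M X τ) : Fact ((∅ : ZFSet.{u}) ∈ M) :=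
  ⟨mem_model_of_mem h.opens_mem h.empty_mem⟩

/-- In `M`, compact Hausdorff spaces are regular. -/
theorem IsCompactIn.isRegular (h : IsTopSpaceIn M X τ) (hc : IsCompactIn M X τ)
    (hH : IsHausdorff X τ) : IsRegular X τ := by
  intro O hO x hx
  have := h.fact_opens
  have := h.fact_empty
  have hxX := h.subset _ hO hx
  have : Fact (x ∈ M) := ⟨mem_model_of_mem h.carrier_mem hxX⟩
  -- Open sets disjoint from some neighborhood of `x`; by the Hausdorff property they cover the
  -- complement of `O`.
  have hA := sep_mem_model h.opens_mem fun R => ∃ P ∈ τ, x ∈ P ∧ P ∩ R = ∅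
  obtain ⟨B, -, hBA, hfin, hB⟩ := hc _ (insert_mem_model (mem_model_of_mem h.opens_mem hO) hA)
    (fun R hR => by
      rcases ZFSet.mem_insert_iff.1 hR with rfl | hR
      exacts [hO, ZFSet.sep_subset hR]) (by
    ext y
    rw [ZFSet.mem_sUnion]
    constructor
    · rintro ⟨R, hR, hy⟩
      rcases ZFSet.mem_insert_iff.1 hR with rfl | hR
      exacts [h.subset _ hO hy, h.subset _ (ZFSet.sep_subset hR) hy]
    · intro hy
      by_cases hyO : y ∈ O
      · exact ⟨O, ZFSet.mem_insert _ _, hyO⟩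
      · obtain ⟨P, hP, R, hR, hxP, hyR, hPR⟩ := hH x hxX y hy (by rintro rfl; exact hyO hx)
        exact ⟨R, ZFSet.mem_insert_of_mem _ (ZFSet.mem_sep.2 ⟨hR, P, hP, hxP, hPR⟩), hyR⟩)
  have key : ∀ s : Set ZFSet.{u}, s.Finite → s ⊆ B → ∃ P ∈ τ, ∃ Q ∈ τ, x ∈ P ∧ P ∩ Q = ∅ ∧
      ∀ R ∈ s, R ⊆ O ∪ Q := by
    intro s hs
    induction s, hs using Set.Finite.induction_on with
    | empty =>
      exact fun _ => ⟨X, h.univ_mem, ∅, h.empty_mem, hxX, by ext; simp, fun _ hR => hR.elim⟩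
    | @insert R s _ _ ih =>
      intro hsB
      obtain ⟨P, hP, Q, hQ, hxP, hPQ, hs⟩ := ih fun R' hR' => hsB (Or.inr hR')
      have hR := hBA (hsB (Or.inl rfl))
      rcases ZFSet.mem_insert_iff.1 hR with rfl | hR
      · refine ⟨P, hP, Q, hQ, hxP, hPQ, ?_⟩
        rintro R' (rfl | hR')
        · exact fun z hz => ZFSet.mem_union.2 (Or.inl hz)
        · exact hs R' hR'
      · obtain ⟨hR, P', hP', hxP', hP'R⟩ := ZFSet.mem_sep.1 hR
        refine ⟨P ∩ P', h.inter_mem _ hP _ hP', Q ∪ R, h.union_mem hQ hR,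
          ZFSet.mem_inter.2 ⟨hxP, hxP'⟩, ?_, ?_⟩
        · ext z
          have e := ZFSet.ext_iff.1 hPQ z
          have e' := ZFSet.ext_iff.1 hP'R z
          simp only [ZFSet.mem_union, ZFSet.mem_inter, ZFSet.notMem_empty] at e e' ⊢
          tauto
        · rintro R' (rfl | hR') z hz
          · simp [hz]
          · have := hs R' hR' hz
            simp only [ZFSet.mem_union] at this ⊢
            tauto
  obtain ⟨P, hP, Q, hQ, hxP, hPQ, hs⟩ := key B hfin subset_rfl
  refine ⟨P, hP, Q, hQ, hxP, fun y hy => ?_, hPQ⟩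
  obtain ⟨hyX, hyO⟩ := ZFSet.mem_sdiff.1 hy
  rw [← hB, ZFSet.mem_sUnion] at hyX
  obtain ⟨R, hR, hyR⟩ := hyX
  exact (ZFSet.mem_union.1 (hs R hR hyR)).resolve_left hyO

/-- The points of a space over `M`: proper filters of open sets which are prime with respect to the
unions of families in `M`. -/
structure IsPoint (M : Set ZFSet.{u}) (X τ : ZFSet.{u}) (G : Set ZFSet.{u}) : Prop where
  isOpen : ∀ O ∈ G, O ∈ τ
  univ : X ∈ G
  empty : ∅ ∉ G
  inter : ∀ O ∈ G, ∀ P ∈ G, O ∩ P ∈ G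
  mono : ∀ O ∈ G, ∀ P ∈ τ, O ⊆ P → P ∈ G
  prime : ∀ A ∈ M, A ⊆ τ → ZFSet.sUnion A ∈ G → ∃ P ∈ A, P ∈ G

theorem IsPoint.union {G : Set ZFSet.{u}} (h : IsTopSpaceIn M X τ) (hG : IsPoint M X τ G)
    {O P : ZFSet.{u}} (hO : O ∈ τ) (hP : P ∈ τ) (hOP : O ∪ P ∈ G) : O ∈ G ∨ P ∈ G := by
  rw [← ZFSet.sUnion_pair] at hOP
  obtain ⟨R, hR, hRG⟩ := hG.prime _ (pair_set_mem_model (mem_model_of_mem h.opens_mem hO)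
    (mem_model_of_mem h.opens_mem hP)) (fun x hx => by
      rcases ZFSet.mem_pair.1 hx with rfl | rfl <;> assumption) hOP
  rcases ZFSet.mem_pair.1 hR with rfl | rfl
  exacts [Or.inl hRG, Or.inr hRG]

/-- By regularity `O` is the union of the open sets well inside it, and this family belongs to `M`,
so primeness applies. -/
theorem IsPoint.exists_wellInside {G : Set ZFSet.{u}} (h : IsTopSpaceIn M X τ)
    (hr : IsRegular X τ) (hG : IsPoint M X τ G) {O : ZFSet.{u}} (hO : O ∈ G) :
    ∃ P ∈ G, WellInside X τ P O := by
  have := h.fact_carrier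
  have := h.fact_opens
  have := h.fact_empty
  have : Fact (O ∈ M) := ⟨mem_model_of_mem h.opens_mem (hG.isOpen _ hO)⟩
  obtain ⟨P, hP, hPG⟩ := hG.prime _ (sep_mem_model h.opens_mem fun P => WellInside X τ P O)
    ZFSet.sep_subset (by
      convert hO
      ext x
      rw [ZFSet.mem_sUnion]
      constructor
      · rintro ⟨P, hP, hx⟩
        rw [ZFSet.mem_sep] at hP
        exact hP.2.subset (h.subset _ hP.1) hx
      · intro hx
        obtain ⟨P, hP, hxP, hPO⟩ := hr.exists_wellInside h (hG.isOpen _ hO) hx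
        exact ⟨P, ZFSet.mem_sep.2 ⟨hP, hPO⟩, hxP⟩)
  exact ⟨P, hPG, (ZFSet.mem_sep.1 hP).2⟩

/-- An ultrafilter on a compact regular space of `M` converges to a point over `M`. -/
theorem IsPoint.of_ultrafilter (h : IsTopSpaceIn M X τ) (hr : IsRegular X τ)
    (hc : IsCompactIn M X τ) (𝒰 : Ultrafilter ZFSet.{u}) (hX : (X : Set ZFSet.{u}) ∈ 𝒰) :
    IsPoint M X τ {O | O ∈ τ ∧ ∃ Q ∈ τ, (Q : Set ZFSet.{u}) ∈ 𝒰 ∧ WellInside X τ Q O} := by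
  refine ⟨fun O hO => hO.1, ⟨h.univ_mem, X, h.univ_mem, hX, ∅, h.empty_mem, ?_, ?_⟩, ?_, ?_, ?_, ?_⟩
  · ext; simp
  · ext; simp
  · rintro ⟨-, Q, hQ, hQU, hQ0⟩
    have : Q ⊆ ∅ := hQ0.subset (h.subset _ hQ)
    rw [(ZFSet.eq_empty Q).2 fun x hx => ZFSet.notMem_empty x (this hx), ZFSet.coe_empty] at hQU
    exact 𝒰.empty_notMem hQU
  · rintro O ⟨hO, Q, hQ, hQU, hQO⟩ O' ⟨hO', Q', hQ', hQU', hQO'⟩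
    refine ⟨h.inter_mem _ hO _ hO', Q ∩ Q', h.inter_mem _ hQ _ hQ', ?_, hQO.inter h hQO'⟩
    rw [ZFSet.coe_inter]
    exact Filter.inter_mem hQU hQU'
  · rintro O ⟨hO, Q, hQ, hQU, hQO⟩ P hP hOP
    exact ⟨hP, Q, hQ, hQU, hQO.mono h hP hOP⟩
  · rintro A hA hAτ ⟨hO, Q, hQ, hQU, R, hR, hAR, hQR⟩
    have := h.fact_carrier
    have := h.fact_opens
    have := h.fact_empty
    have : Fact (A ∈ M) := ⟨hA⟩
    -- `R` together with the sets well inside members of `A` covers the space. The ultrafilter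
    -- contains a member of a finite subcover, and this cannot be `R`, which is disjoint from `Q`.
    have hC := sep_mem_model h.opens_mem fun P => ∃ a ∈ A, WellInside X τ P a
    obtain ⟨B, -, hBA, hfin, hB⟩ := hc _ (insert_mem_model (mem_model_of_mem h.opens_mem hR) hC)
      (fun R' hR' => by
        rcases ZFSet.mem_insert_iff.1 hR' with rfl | hR'
        exacts [hR, ZFSet.sep_subset hR']) (by
      ext y
      rw [ZFSet.mem_sUnion]
      constructor
      · rintro ⟨R', hR', hy⟩
        rcases ZFSet.mem_insert_iff.1 hR' with rfl | hR'
        exacts [h.subset _ hR hy, h.subset _ (ZFSet.sep_subset hR') hy]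
      · intro hy
        rw [← hAR, ZFSet.mem_union, ZFSet.mem_sUnion] at hy
        rcases hy with ⟨a, ha, hy⟩ | hy
        · obtain ⟨P, hP, hyP, hPa⟩ := hr.exists_wellInside h (hAτ ha) hy
          exact ⟨P, ZFSet.mem_insert_of_mem _ (ZFSet.mem_sep.2 ⟨hP, a, ha, hPa⟩), hyP⟩
        · exact ⟨R, ZFSet.mem_insert _ _, hy⟩)
    rw [← hB, ZFSet.coe_sUnion, Ultrafilter.finite_sUnion_mem_iff (hfin.image _)] at hX
    obtain ⟨-, ⟨b, hb, rfl⟩, hbU⟩ := hX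
    rcases ZFSet.mem_insert_iff.1 (hBA hb) with rfl | hbC
    · refine absurd (Filter.inter_mem hQU hbU) ?_
      rw [← ZFSet.coe_inter, hQR, ZFSet.coe_empty]
      exact 𝒰.empty_notMem
    · obtain ⟨hbτ, a, ha, hba⟩ := ZFSet.mem_sep.1 hbC
      exact ⟨a, ha, hAτ ha, b, hbτ, hbU, hba⟩

end TopologyInModel

/-! ### Baire category in `M` and Gδ subsets of compact spaces. -/

section Baire

variable {M : Set ZFSet.{u}} [hM : Fact (IsTransitiveModel M)] {K κ : ZFSet.{u}}

/-- `ω` is recovered as the domain of `g`. -/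
theorem omega_mem_model_of_isFunc {a g : ZFSet.{u}} (hg : g ∈ M)
    (hf : ZFSet.IsFunc ZFSet.omega a g) : ZFSet.omega.{u} ∈ M := by
  have : Fact (g ∈ M) := ⟨hg⟩
  convert sep_mem_model (sUnion_mem_model (sUnion_mem_model hg)) fun n =>
    ∃ w ∈ M, ZFSet.pair n w ∈ g using 1
  ext n
  rw [ZFSet.mem_sep]
  constructor
  · intro hn
    obtain ⟨w, hw, -⟩ := hf.2 n hn
    refine ⟨?_, w, (mem_model_of_pair_mem hg hw).2, hw⟩
    exact ZFSet.mem_sUnion.2 ⟨{n}, ZFSet.mem_sUnion.2 ⟨_, hw, ZFSet.mem_pair.2 (Or.inl rfl)⟩,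
      ZFSet.mem_singleton.2 rfl⟩
  · rintro ⟨-, w, -, hw⟩
    exact (ZFSet.pair_mem_prod.1 (hf.1 hw)).1

/-- Supplies the grading of a tree of pairs `(n, W)`: the rank grows in passing from `n` to `insert
n n`. -/
theorem exists_rank_fst : ∃ lev : ZFSet.{u} → Ordinal.{u},
    ∀ n W, lev (ZFSet.pair n W) = ZFSet.rank n := by
  have hinj : Function.Injective fun p : ZFSet.{u} × ZFSet.{u} => ZFSet.pair p.1 p.2 :=
    fun p q h => Prod.ext_iff.2 (ZFSet.pair_inj.1 h)
  exact ⟨Function.extend (fun p : ZFSet.{u} × ZFSet.{u} => ZFSet.pair p.1 p.2)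
    (fun p => ZFSet.rank p.1) 0, fun n W => hinj.extend_apply _ _ (n, W)⟩

/-- The Baire category argument inside `M`: a sequence of open subsets of a compact space, each well
inside the previous one and in a member of the given sequence of open sets, whose range is in `M`,
has a common point. -/
theorem exists_mem_of_wellInside_sequence (h : IsTopSpaceIn M K κ) (hc : IsCompactIn M K κ)
    {O' T : ZFSet.{u}} (hO' : O' ∈ κ) (hT : T ∈ M) {W U : ℕ → ZFSet.{u}} (hW : ∀ n, W n ∈ κ)
    (hTW : ∀ x, x ∈ T ↔ ∃ n, x = ZFSet.pair (vonNeumannNat n) (W n))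
    (hWU : ∀ n, WellInside K κ (W (n + 1)) (W n ∩ U n)) (hWO' : ∀ n, ¬ W n ⊆ O') :
    ∃ x ∈ K, x ∉ O' ∧ x ∈ W 0 ∧ ∀ n, x ∈ U n := by
  have := h.fact_opens
  have := h.fact_empty
  have : Fact (T ∈ M) := ⟨hT⟩
  have hsub : ∀ n, W (n + 1) ⊆ W n ∩ U n := fun n => (hWU n).subset (h.subset _ (hW _))
  have hanti : ∀ m n, m ≤ n → W n ⊆ W m := by
    intro m n hmn
    induction hmn with
    | refl => exact fun _ hx => hx
    | step _ ih => exact fun x hx => ih (ZFSet.mem_inter.1 (hsub _ hx)).1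
  have hA := sep_mem_model h.opens_mem fun R =>
    ∃ V ∈ κ, (∃ n ∈ M, ZFSet.pair n V ∈ T) ∧ V ∩ R = ∅
  have hTV : ∀ V, (∃ n ∈ M, ZFSet.pair n V ∈ T) ↔ ∃ n, V = W n := by
    intro V
    constructor
    · rintro ⟨k, -, hk⟩
      obtain ⟨n, hn⟩ := (hTW _).1 hk
      exact ⟨n, (ZFSet.pair_inj.1 hn).2⟩
    · rintro ⟨n, rfl⟩
      have hn := (hTW _).2 ⟨n, rfl⟩
      exact ⟨_, (mem_model_of_pair_mem hT hn).1, hn⟩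
  simp only [hTV] at hA
  set A := ZFSet.sep (fun R => ∃ V ∈ κ, (∃ n, V = W n) ∧ V ∩ R = ∅) κ with hAdef
  have hmemA : ∀ R, R ∈ A ↔ R ∈ κ ∧ ∃ n, W n ∩ R = ∅ := by
    intro R
    rw [hAdef, ZFSet.mem_sep]
    constructor
    · rintro ⟨hR, _, -, ⟨n, rfl⟩, hn⟩
      exact ⟨hR, n, hn⟩
    · rintro ⟨hR, n, hn⟩
      exact ⟨hR, _, hW n, ⟨n, rfl⟩, hn⟩
  have hA' : insert O' A ⊆ κ := fun R hR => by
    rcases ZFSet.mem_insert_iff.1 hR with rfl | hR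
    exacts [hO', ZFSet.sep_subset hR]
  -- A point outside all members of `A` lies in the closure of every `W n`, hence in every `W n ∩ U
  -- n`. If there is none outside `O'`, a finite subcover forces some `W m ⊆ O'`.
  by_cases hcov : ∃ x ∈ K, ∀ R ∈ (insert O' A : ZFSet.{u}), x ∉ R
  · obtain ⟨x, hxK, hx⟩ := hcov
    have hxW : ∀ n, x ∈ W n ∩ U n := by
      intro n
      obtain ⟨R, hR, h₁, h₂⟩ := hWU n
      have hxR := hx R (ZFSet.mem_insert_of_mem _ ((hmemA R).2 ⟨hR, n + 1, h₂⟩))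
      rw [← h₁, ZFSet.mem_union] at hxK
      exact hxK.resolve_right hxR
    exact ⟨x, hxK, hx O' (ZFSet.mem_insert _ _), (ZFSet.mem_inter.1 (hxW 0)).1,
      fun n => (ZFSet.mem_inter.1 (hxW n)).2⟩
  · push Not at hcov
    obtain ⟨B, -, hBA, hfin, hB⟩ := hc _
      (insert_mem_model (mem_model_of_mem h.opens_mem hO') hA) hA' (by
        ext x
        rw [ZFSet.mem_sUnion]
        exact ⟨fun ⟨R, hR, hxR⟩ => h.subset _ (hA' hR) hxR, hcov x⟩)
    have hBn : ∀ R, ∃ n, R ∈ B → W n ∩ R ⊆ O' := by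
      intro R
      by_cases hR : R ∈ B
      · rcases ZFSet.mem_insert_iff.1 (hBA hR) with rfl | hRA
        · exact ⟨0, fun _ x hx => (ZFSet.mem_inter.1 hx).2⟩
        · obtain ⟨n, hn⟩ := ((hmemA R).1 hRA).2
          refine ⟨n, fun _ x hx => ?_⟩
          rw [hn] at hx
          exact absurd hx (ZFSet.notMem_empty x)
      · exact ⟨0, fun h => absurd h hR⟩
    choose k hk using hBn
    obtain ⟨m, hm⟩ := (hfin.image k).bddAbove
    refine absurd (fun x hx => ?_) (hWO' m)
    have hxK := h.subset _ (hW m) hx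
    rw [← hB, ZFSet.mem_sUnion] at hxK
    obtain ⟨R, hR, hxR⟩ := hxK
    exact hk R hR (ZFSet.mem_inter.2 ⟨hanti _ _ (hm ⟨R, hR, rfl⟩) hx, hxR⟩)

/-- If in `M` an open set `O` is covered by `O'` on a `Gδ` subset of a compact space, then this
remains true for the points over `M`. -/
theorem IsPoint.mem_of_inter_gdelta_subset (h : IsTopSpaceIn M K κ) (hr : IsRegular K κ)
    (hc : IsCompactIn M K κ) {F : Set ZFSet.{u}} (hF : IsPoint M K κ F) {g O O' : ZFSet.{u}}
    (hg : g ∈ M) (hgf : ZFSet.IsFunc ZFSet.omega κ g) (hO : O ∈ F) (hO' : O' ∈ κ)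
    (hU : ∀ n ∈ ZFSet.omega, ∀ U ∈ κ, ZFSet.pair n U ∈ g → U ∈ F)
    (hsub : ∀ x ∈ O, (∀ n ∈ ZFSet.omega, ∀ U ∈ κ, ZFSet.pair n U ∈ g → x ∈ U) → x ∈ O') :
    O' ∈ F := by
  by_contra hO'F
  have hω := omega_mem_model_of_isFunc hg hgf
  have := h.fact_carrier
  have := h.fact_opens
  have := h.fact_empty
  have : Fact (g ∈ M) := ⟨hg⟩
  have : Fact (O' ∈ M) := ⟨mem_model_of_mem h.opens_mem hO'⟩
  have : Fact (ZFSet.omega.{u} ∈ M) := ⟨hω⟩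
  have hN := prod_mem_model hω h.opens_mem
  have hnat : ∀ n, vonNeumannNat.{u} n ∈ ZFSet.omega.{u} := fun n => mem_omega_iff.2 ⟨n, rfl⟩
  -- The tree of attempts to shrink into the Gδ set while never being contained in `O'`.
  have hE := sep_mem_model (prod_mem_model hN hN) fun p =>
    ∃ n ∈ ZFSet.omega, ∃ W ∈ κ, ∃ W' ∈ κ, ∃ U ∈ κ,
      p = ZFSet.pair (ZFSet.pair n W) (ZFSet.pair (insert n n) W') ∧ ZFSet.pair n U ∈ g ∧
        WellInside K κ W' (W ∩ U) ∧ ¬ W ⊆ O'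
  set E := ZFSet.sep (fun p => ∃ n ∈ ZFSet.omega, ∃ W ∈ κ, ∃ W' ∈ κ, ∃ U ∈ κ,
      p = ZFSet.pair (ZFSet.pair n W) (ZFSet.pair (insert n n) W') ∧ ZFSet.pair n U ∈ g ∧
        WellInside K κ W' (W ∩ U) ∧ ¬ W ⊆ O') (ZFSet.prod (ZFSet.prod ZFSet.omega κ)
          (ZFSet.prod ZFSet.omega κ)) with hEdef
  have hEmem : ∀ b c, ZFSet.pair b c ∈ E → ∃ n ∈ ZFSet.omega, ∃ W ∈ κ, ∃ W' ∈ κ, ∃ U ∈ κ,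
      (b = ZFSet.pair n W ∧ c = ZFSet.pair (insert n n) W') ∧ ZFSet.pair n U ∈ g ∧
        WellInside K κ W' (W ∩ U) ∧ ¬ W ⊆ O' := by
    intro b c hbc
    simpa only [ZFSet.pair_inj] using (ZFSet.mem_sep.1 hbc).2
  have hstep : ∀ (n : ℕ) (W : {W // W ∈ F}), ∃ W' : {W // W ∈ F}, ∃ U ∈ κ,
      ZFSet.pair (vonNeumannNat n) U ∈ g ∧ WellInside K κ W'.1 (W.1 ∩ U) := by
    intro n W
    obtain ⟨U, hnU, -⟩ := hgf.2 _ (hnat n)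
    have hUκ := (ZFSet.pair_mem_prod.1 (hgf.1 hnU)).2
    obtain ⟨W', hW', hin⟩ := hF.exists_wellInside h hr
      (hF.inter _ W.2 _ (hU _ (hnat n) U hUκ hnU))
    exact ⟨⟨W', hW'⟩, U, hUκ, hnU, hin⟩
  choose nxt hnxt using hstep
  -- A branch through `F`, available only in the universe because `F` need not be in `M`. The branch
  -- found in `M` below shares its first node `O` but may leave `F`.
  let W : ℕ → {W // W ∈ F} := fun n => Nat.rec ⟨O, hO⟩ nxt n
  have hWE : ∀ n, ZFSet.pair (ZFSet.pair (vonNeumannNat n) (W n).1)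
      (ZFSet.pair (vonNeumannNat (n + 1)) (W (n + 1)).1) ∈ E := by
    intro n
    obtain ⟨U, hUκ, hnU, hin⟩ := hnxt n (W n)
    have hn := hF.isOpen _ (W n).2
    have hn' := hF.isOpen _ (W (n + 1)).2
    refine ZFSet.mem_sep.2 ⟨ZFSet.pair_mem_prod.2 ⟨ZFSet.pair_mem_prod.2 ⟨hnat n, hn⟩,
      ZFSet.pair_mem_prod.2 ⟨hnat (n + 1), hn'⟩⟩, _, hnat n, _, hn, _, hn', U, hUκ, rfl, hnU, hin,
      fun hWO' => hO'F (hF.mono _ (W n).2 _ hO' hWO')⟩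
  obtain ⟨lev, hlev⟩ := exists_rank_fst
  obtain ⟨T, hT, s, hTs, hs0, hsE⟩ := exists_branch_mem_model hN hE ZFSet.sep_subset lev (by
    intro b c hbc
    obtain ⟨n, -, V, -, V', -, -, -, ⟨rfl, rfl⟩, -⟩ := hEmem b c hbc
    rw [hlev, hlev]
    exact ZFSet.rank_lt_of_mem (ZFSet.mem_insert _ _)) hWE
  have hsn : ∀ n, ∃ V, s n = ZFSet.pair (vonNeumannNat n) V := by
    intro n
    induction n with
    | zero => exact ⟨_, hs0⟩
    | succ n ih =>
      obtain ⟨V, hV⟩ := ih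
      obtain ⟨k, -, V₁, -, V', -, -, -, ⟨h₁, h₂⟩, -⟩ := hEmem _ _ (hsE n)
      rw [hV] at h₁
      obtain ⟨rfl, rfl⟩ := ZFSet.pair_inj.1 h₁
      exact ⟨V', h₂⟩
  choose V hV using hsn
  have hVU : ∀ n, ∃ U, V n ∈ κ ∧ U ∈ κ ∧ ZFSet.pair (vonNeumannNat n) U ∈ g ∧
      WellInside K κ (V (n + 1)) (V n ∩ U) ∧ ¬ V n ⊆ O' := by
    intro n
    obtain ⟨k, -, V₁, hV₁, V', -, U, hUκ, ⟨h₁, h₂⟩, hkU, hin, hne⟩ := hEmem _ _ (hsE n)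
    rw [hV] at h₁ h₂
    obtain ⟨rfl, rfl⟩ := ZFSet.pair_inj.1 h₁
    obtain ⟨-, rfl⟩ := ZFSet.pair_inj.1 h₂
    exact ⟨U, hV₁, hUκ, hkU, hin, hne⟩
  choose U hVκ hUκ hgU hin hne using hVU
  obtain ⟨x, hxK, hxO', hx0, hxU⟩ := exists_mem_of_wellInside_sequence h hc hO' hT hVκ
    (by simpa only [hV] using hTs) hin hne
  obtain rfl : V 0 = O := (ZFSet.pair_inj.1 ((hV 0).symm.trans hs0)).2
  refine hxO' (hsub x hx0 fun n hn U' hU' hnU' => ?_)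
  obtain ⟨m, rfl⟩ := mem_omega_iff.1 hn
  rw [(hgf.2 _ hn).unique hnU' (hgU m)]
  exact hxU m

end Baire

/-! ### Pushing points forward and lifting them along open maps. -/

section Lifting

variable {M : Set ZFSet.{u}} {X τ Y σ f : ZFSet.{u}}

theorem exists_fun_of_isFunc (hf : ZFSet.IsFunc X Y f) : ∃ φ : ZFSet.{u} → ZFSet.{u},
    (∀ x ∈ X, φ x ∈ Y) ∧ (∀ x ∈ X, ∀ y, ZFSet.pair x y ∈ f ↔ y = φ x) ∧
    (∀ x B, x ∈ preimg f X B ↔ x ∈ X ∧ φ x ∈ B) ∧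
    ∀ y A, A ⊆ X → (y ∈ img f A Y ↔ ∃ x ∈ A, φ x = y) := by
  choose φ hφ hu using hf.2
  have h₁ : ∀ x (hx : x ∈ X), φ x hx ∈ Y := fun x hx => (ZFSet.pair_mem_prod.1 (hf.1 (hφ x hx))).2
  have h₂ : ∀ x (hx : x ∈ X) y, ZFSet.pair x y ∈ f ↔ y = φ x hx := fun x hx y =>
    ⟨fun h => hu x hx y h, fun h => h ▸ hφ x hx⟩
  classical
  -- The value off `X` is immaterial.
  refine ⟨fun x => if hx : x ∈ X then φ x hx else ∅, fun x hx => ?_, fun x hx y => ?_,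
    fun x B => ?_, fun y A hA => ?_⟩
  · simpa [hx] using h₁ x hx
  · simpa [hx] using h₂ x hx y
  · rw [preimg, ZFSet.mem_sep]
    refine and_congr_right fun hx => ?_
    simp [hx, h₂ x hx]
  · rw [img, ZFSet.mem_sep]
    constructor
    · rintro ⟨-, x, hx, hxy⟩
      refine ⟨x, hx, ?_⟩
      simp [hA hx, (h₂ x (hA hx) y).1 hxy]
    · rintro ⟨x, hx, rfl⟩
      simp only [hA hx, dite_true]
      exact ⟨h₁ x (hA hx), x, hx, hφ x (hA hx)⟩

variable [hM : Fact (IsTransitiveModel M)]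

instance DefTerm.img {ι : Type} (f A Y : (ι → ZFSet.{u}) → ZFSet.{u}) [hf : DefTerm M f]
    [hA : DefTerm M A] [hY : DefTerm M Y] : DefTerm M fun v => img (f v) (A v) (Y v) := by
  have := hA.reindex (Sum.inl : ι → ι ⊕ Fin 1)
  have := hf.reindex (fun i => (Sum.inl (Sum.inl i) : (ι ⊕ Fin 1) ⊕ Fin 1))
  unfold ModelTop.img
  infer_instance

/-- In a regular space, two points over `M` whose neighborhoods meet are equal. -/
theorem IsPoint.subset_of_meet (h : IsTopSpaceIn M X τ) (hr : IsRegular X τ)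
    {G G' : Set ZFSet.{u}} (hG : IsPoint M X τ G) (hG' : IsPoint M X τ G')
    (hGG' : ∀ P ∈ G, ∀ Q ∈ G', P ∩ Q ≠ ∅) : G ⊆ G' := by
  intro P hP
  -- `P ∪ Q` is the whole space, so `G'` contains `P` or `Q`; the latter is disjoint from `P' ∈ G`.
  obtain ⟨P', hP', Q, hQ, h₁, h₂⟩ := hG.exists_wellInside h hr hP
  refine (hG'.union h (hG.isOpen _ hP) hQ (h₁ ▸ hG'.univ)).resolve_right fun hQG' => ?_
  exact hGG' P' hP' Q hQG' h₂

/-- Continuous functions act on points over `M`. -/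
theorem IsPoint.map (hX : IsTopSpaceIn M X τ) (hY : IsTopSpaceIn M Y σ)
    (hf : IsContinuousIn M X τ Y σ f) {F : Set ZFSet.{u}} (hF : IsPoint M X τ F) :
    IsPoint M Y σ {P | P ∈ σ ∧ preimg f X P ∈ F} := by
  obtain ⟨φ, hφ, -, hpre, -⟩ := exists_fun_of_isFunc hf.isFunc
  refine ⟨fun P hP => hP.1, ⟨hY.univ_mem, ?_⟩, fun h => ?_, fun P hP Q hQ => ?_,
    fun P hP Q hQ hPQ => ?_, fun A hA hAσ h => ?_⟩
  · convert hF.univ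
    ext x
    rw [hpre]
    exact and_iff_left_of_imp (hφ x)
  · refine hF.empty ?_
    convert h.2
    ext x
    simp [hpre]
  · refine ⟨hY.inter_mem _ hP.1 _ hQ.1, ?_⟩
    convert hF.inter _ hP.2 _ hQ.2 using 1
    ext x
    simp only [hpre, ZFSet.mem_inter]
    tauto
  · refine ⟨hQ, hF.mono _ hP.2 _ (hf.preimg_mem _ hQ) fun x hx => ?_⟩
    rw [hpre] at hx ⊢
    exact ⟨hx.1, hPQ hx.2⟩
  · have : Fact (A ∈ M) := ⟨hA⟩
    have := hX.fact_carrier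
    have : Fact (f ∈ M) := ⟨hf.mem⟩
    obtain ⟨O, hO, hOF⟩ := hF.prime _ (sep_mem_model hX.opens_mem fun O =>
      ∃ P ∈ A, O = preimg f X P) ZFSet.sep_subset (by
        convert h.2
        ext x
        rw [hpre, ZFSet.mem_sUnion, ZFSet.mem_sUnion]
        constructor
        · rintro ⟨O, hO, hx⟩
          obtain ⟨-, P, hP, rfl⟩ := ZFSet.mem_sep.1 hO
          rw [hpre] at hx
          exact ⟨hx.1, P, hP, hx.2⟩
        · rintro ⟨hx, P, hP, hxP⟩
          exact ⟨_, ZFSet.mem_sep.2 ⟨hf.preimg_mem _ (hAσ hP), P, hP, rfl⟩,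
            (hpre _ _).2 ⟨hx, hxP⟩⟩)
    obtain ⟨-, P, hP, rfl⟩ := ZFSet.mem_sep.1 hO
    exact ⟨P, hP, hAσ hP, hOF⟩

/-- Points over `M` lift along open continuous functions defined on interpretable spaces. -/
theorem IsPoint.exists_lift (hX : IsInterpretableIn M X τ) (hY : IsInterpretableIn M Y σ)
    (hf : IsContinuousIn M X τ Y σ f) (hfo : IsOpenFun τ Y σ f) {G : Set ZFSet.{u}}
    (hG : IsPoint M Y σ G) {O : ZFSet.{u}} (hO : O ∈ τ) (hOG : img f O Y ∈ G) :
    ∃ F, IsPoint M X τ F ∧ O ∈ F ∧ ∀ P ∈ σ, preimg f X P ∈ F ↔ P ∈ G := by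
  obtain ⟨hXt, -, -, Z, ζ, p, ⟨hZ, K, κ, e, hK, hKH, hKc, he, g, hg, hgf, hgi⟩, hp, hpo, hpX⟩ := hX
  obtain ⟨hYt, -, hYr, -⟩ := hY
  have hKr := hKc.isRegular hK hKH
  obtain ⟨ε, hε, -, hεpre, hεimg⟩ := exists_fun_of_isFunc he.isFunc
  obtain ⟨ψ, hψ, hψp, hψpre, hψimg⟩ := exists_fun_of_isFunc hp.isFunc
  obtain ⟨φ, hφ, -, hφpre, hφimg⟩ := exists_fun_of_isFunc hf.isFunc
  have := hK.fact_carrier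
  have := hK.fact_opens
  have := hK.fact_empty
  have := hXt.fact_carrier
  have := hYt.fact_carrier
  have := hZ.fact_carrier
  have : Fact (f ∈ M) := ⟨hf.mem⟩
  have : Fact (p ∈ M) := ⟨hp.mem⟩
  have : Fact (e ∈ M) := ⟨he.mem⟩
  have hnat : ∀ n, vonNeumannNat.{u} n ∈ ZFSet.omega.{u} := fun n => mem_omega_iff.2 ⟨n, rfl⟩
  have hε_iff : ∀ x ∈ K, (∃ z ∈ Z, ε z = x) ↔
      ∀ n ∈ ZFSet.omega, ∀ U ∈ κ, ZFSet.pair n U ∈ g → x ∈ U := by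
    intro x hx
    rw [← hεimg x Z fun _ h => h, hgi, and_iff_right hx]
  have hεU : ∀ z ∈ Z, ∀ n ∈ ZFSet.omega, ∀ U ∈ κ, ZFSet.pair n U ∈ g → ε z ∈ U := fun z hz =>
    (hε_iff _ (hε z hz)).1 ⟨z, hz, rfl⟩
  have hopen : ∀ V ∈ κ, img f (img p (preimg e Z V) X) Y ∈ σ := fun V hV =>
    hfo _ (hpo _ ((he.opens_iff _).2 ⟨V, hV, rfl⟩))
  have hsub : ∀ A, img p A X ⊆ X := fun _ => ZFSet.sep_subset
  have hsub' : ∀ B, preimg e Z B ⊆ Z := fun _ => ZFSet.sep_subset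
  have himg : ∀ V y, y ∈ img f (img p (preimg e Z V) X) Y ↔
      ∃ z ∈ Z, ε z ∈ V ∧ φ (ψ z) = y := by
    intro V y
    rw [hφimg y _ (hsub _)]
    constructor
    · rintro ⟨x, hx, rfl⟩
      rw [hψimg x _ (hsub' _)] at hx
      obtain ⟨z, hz, rfl⟩ := hx
      rw [hεpre] at hz
      exact ⟨z, hz.1, hz.2, rfl⟩
    · rintro ⟨z, hz, hzV, rfl⟩
      exact ⟨ψ z, (hψimg _ _ (hsub' _)).2 ⟨z, (hεpre _ _).2 ⟨hz, hzV⟩, rfl⟩, rfl⟩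
  -- A sequence of open subsets of `K` which shrinks to a compact set in the fiber.
  obtain ⟨V₀, hV₀, hOV₀⟩ := (he.opens_iff _).1 (hp.preimg_mem O hO)
  have hO_iff : ∀ z ∈ Z, (ψ z ∈ O ↔ ε z ∈ V₀) := fun z hz => by
    have := ZFSet.ext_iff.1 hOV₀ z
    rwa [hψpre, hεpre, and_iff_right hz, and_iff_right hz] at this
  have hstart : img f (img p (preimg e Z V₀) X) Y ∈ G := by
    convert hOG using 1
    ext y
    rw [himg, hφimg y O (hXt.subset _ hO)]
    constructor
    · rintro ⟨z, hz, hzV, rfl⟩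
      exact ⟨ψ z, (hO_iff z hz).2 hzV, rfl⟩
    · rintro ⟨x, hx, rfl⟩
      obtain ⟨z, hz, hzx⟩ := hpX x (hXt.subset _ hO hx)
      obtain rfl := (hψp z hz x).1 hzx
      exact ⟨z, hz, (hO_iff z hz).1 hx, rfl⟩
  have hstep : ∀ (n : ℕ) (V : {V // V ∈ κ ∧ img f (img p (preimg e Z V) X) Y ∈ G}),
      ∃ V' : {V // V ∈ κ ∧ img f (img p (preimg e Z V) X) Y ∈ G}, ∃ U ∈ κ,
        ZFSet.pair (vonNeumannNat n) U ∈ g ∧ WellInside K κ V'.1 (V.1 ∩ U) := by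
    rintro n ⟨V, hV, hVG⟩
    obtain ⟨U, hnU, -⟩ := hgf.2 _ (hnat n)
    have hU := (ZFSet.pair_mem_prod.1 (hgf.1 hnU)).2
    have hVU := hK.inter_mem _ hV _ hU
    have : Fact (V ∩ U ∈ M) := ⟨mem_model_of_mem hK.opens_mem hVU⟩
    -- Points of `Z` lie in `U`, so by regularity of `K` the images of the sets well inside `V ∩ U`
    -- cover the image of `V`; primeness of `G` selects one.
    have hA := sep_mem_model hYt.opens_mem fun P => ∃ V' ∈ κ,
      WellInside K κ V' (V ∩ U) ∧ P = img f (img p (preimg e Z V') X) Y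
    obtain ⟨P, hP, hPG⟩ := hG.prime _ hA ZFSet.sep_subset
      (hG.mono _ hVG _ (hYt.sUnion_mem _ hA ZFSet.sep_subset) (by
        intro y hy
        rw [himg] at hy
        obtain ⟨z, hz, hzV, rfl⟩ := hy
        obtain ⟨V', hV', hzV', hin⟩ := hKr.exists_wellInside hK hVU
          (ZFSet.mem_inter.2 ⟨hzV, hεU z hz _ (hnat n) U hU hnU⟩)
        exact ZFSet.mem_sUnion.2 ⟨_, ZFSet.mem_sep.2 ⟨hopen V' hV', V', hV', hin, rfl⟩,
          (himg _ _).2 ⟨z, hz, hzV', rfl⟩⟩))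
    obtain ⟨-, V', hV', hin, rfl⟩ := ZFSet.mem_sep.1 hP
    exact ⟨⟨V', hV', hPG⟩, U, hU, hnU, hin⟩
  choose nxt hnxt using hstep
  let V : ℕ → {V // V ∈ κ ∧ img f (img p (preimg e Z V) X) Y ∈ G} :=
    fun n => Nat.rec ⟨V₀, hV₀, hstart⟩ nxt n
  have hVU : ∀ n, ∃ U ∈ κ, ZFSet.pair (vonNeumannNat n) U ∈ g ∧
      WellInside K κ (V (n + 1)).1 ((V n).1 ∩ U) := fun n => hnxt n (V n)
  have hanti : ∀ m n, m ≤ n → (V n).1 ⊆ (V m).1 := by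
    intro m n hmn
    induction hmn with
    | refl => exact fun _ hx => hx
    | @step n _ ih =>
      obtain ⟨U, -, -, hin⟩ := hVU n
      exact fun x hx => ih (ZFSet.mem_inter.1 (hin.subset (hK.subset _ (V (n + 1)).2.1) hx)).1
  -- An ultrafilter on the part of `Z` over the given point.
  let S : ℕ × G → Set ZFSet.{u} := fun i => {z | z ∈ Z ∧ ε z ∈ (V i.1).1 ∧ φ (ψ z) ∈ i.2.1}
  have hSne : ∀ i, (S i).Nonempty := by
    rintro ⟨n, P, hP⟩
    by_contra hcon
    refine hG.empty ?_
    convert hG.inter _ (V n).2.2 _ hP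
    symm
    rw [ZFSet.eq_empty]
    intro y hy
    rw [ZFSet.mem_inter, himg] at hy
    obtain ⟨⟨z, hz, hzV, rfl⟩, hzP⟩ := hy
    exact hcon ⟨z, hz, hzV, hzP⟩
  have hdir : Directed (· ≥ ·) fun i => Filter.principal (S i) := by
    rintro ⟨m, P, hP⟩ ⟨n, Q, hQ⟩
    refine ⟨⟨max m n, P ∩ Q, hG.inter _ hP _ hQ⟩, Filter.principal_mono.2 ?_,
      Filter.principal_mono.2 ?_⟩
    · rintro z ⟨hz, hzV, hzP⟩
      exact ⟨hz, hanti _ _ (le_max_left m n) hzV, (ZFSet.mem_inter.1 hzP).1⟩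
    · rintro z ⟨hz, hzV, hzP⟩
      exact ⟨hz, hanti _ _ (le_max_right m n) hzV, (ZFSet.mem_inter.1 hzP).2⟩
  have : Nonempty (ℕ × G) := ⟨0, Y, hG.univ⟩
  have : (⨅ i, Filter.principal (S i)).NeBot :=
    Filter.iInf_neBot_of_directed' hdir fun i => Filter.principal_neBot_iff.2 (hSne i)
  let 𝒰 := Ultrafilter.of (⨅ i, Filter.principal (S i))
  have hS𝒰 : ∀ i, S i ∈ 𝒰 := fun i => Ultrafilter.of_le _
    (Filter.mem_iInf_of_mem i (Filter.mem_principal_self _))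
  have hF := IsPoint.of_ultrafilter hK hKr hKc (𝒰.map ε)
    (Ultrafilter.mem_map.2 (Filter.mem_of_superset (hS𝒰 ⟨0, Y, hG.univ⟩) fun z hz => hε z hz.1))
  set F : Set ZFSet.{u} := {U | U ∈ κ ∧ ∃ Q ∈ κ, (Q : Set ZFSet.{u}) ∈ 𝒰.map ε ∧
    WellInside K κ Q U} with hFdef
  have hVUF : ∀ n, ∃ U ∈ κ, ZFSet.pair (vonNeumannNat n) U ∈ g ∧ (V n).1 ∩ U ∈ F := by
    intro n
    obtain ⟨U, hU, hnU, hin⟩ := hVU n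
    exact ⟨U, hU, hnU, hK.inter_mem _ (V n).2.1 _ hU, _, (V (n + 1)).2.1,
      Ultrafilter.mem_map.2 (Filter.mem_of_superset (hS𝒰 ⟨n + 1, Y, hG.univ⟩) fun z hz => hz.2.1),
      hin⟩
  have hUF : ∀ n ∈ ZFSet.omega, ∀ U ∈ κ, ZFSet.pair n U ∈ g → U ∈ F := by
    intro n hn U hU hnU
    obtain ⟨k, rfl⟩ := mem_omega_iff.1 hn
    obtain ⟨U', hU', hnU', hF'⟩ := hVUF k
    rw [(hgf.2 _ hn).unique hnU hnU']
    exact hF.mono _ hF' _ hU' fun x hx => (ZFSet.mem_inter.1 hx).2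
  have hFZ : ∀ U ∈ F, ∀ U' ∈ κ, (∀ z ∈ Z, ε z ∈ U → ε z ∈ U') → U' ∈ F := by
    intro U hU U' hU' hUU'
    refine hF.mem_of_inter_gdelta_subset hK hKr hKc hg hgf hU hU' hUF fun x hx hxU => ?_
    obtain ⟨z, hz, rfl⟩ := (hε_iff x (hK.subset _ (hF.isOpen _ hU) hx)).2 hxU
    exact hUU' z hz hx
  -- The image of `F` under `p`, phrased through traces on `Z` because `F` is a point of `K`; `hFZ`
  -- makes membership depend on traces only.
  have hFX : IsPoint M X τ {A | A ∈ τ ∧ ∃ U ∈ F, ∀ z ∈ Z, ε z ∈ U → ψ z ∈ A} := by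
    refine ⟨fun A hA => hA.1, ⟨hXt.univ_mem, K, hF.univ, fun z hz _ => hψ z hz⟩, ?_, ?_, ?_, ?_⟩
    · rintro ⟨-, U, hU, hUZ⟩
      exact hF.empty (hFZ U hU ∅ hK.empty_mem fun z hz hzU =>
        absurd (hUZ z hz hzU) (ZFSet.notMem_empty _))
    · rintro A ⟨hA, U, hU, hUA⟩ B ⟨hB, U', hU', hUB⟩
      refine ⟨hXt.inter_mem _ hA _ hB, _, hF.inter _ hU _ hU', fun z hz hzU => ?_⟩
      rw [ZFSet.mem_inter] at hzU ⊢
      exact ⟨hUA z hz hzU.1, hUB z hz hzU.2⟩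
    · rintro A ⟨hA, U, hU, hUA⟩ B hB hAB
      exact ⟨hB, U, hU, fun z hz hzU => hAB (hUA z hz hzU)⟩
    · rintro A hA hAτ ⟨-, U, hU, hUA⟩
      have : Fact (A ∈ M) := ⟨hA⟩
      have hC := sep_mem_model hK.opens_mem fun U' =>
        ∃ a ∈ A, preimg e Z U' ⊆ preimg p Z a
      obtain ⟨U', hU', hU'F⟩ := hF.prime _ hC ZFSet.sep_subset
        (hFZ U hU _ (hK.sUnion_mem _ hC ZFSet.sep_subset) fun z hz hzU => by
          obtain ⟨a, ha, hza⟩ := ZFSet.mem_sUnion.1 (hUA z hz hzU)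
          obtain ⟨U', hU', haU'⟩ := (he.opens_iff _).1 (hp.preimg_mem a (hAτ ha))
          have hzU' : z ∈ preimg e Z U' := haU' ▸ (hψpre z a).2 ⟨hz, hza⟩
          exact ZFSet.mem_sUnion.2 ⟨U', ZFSet.mem_sep.2 ⟨hU', a, ha, fun w hw => haU' ▸ hw⟩,
            ((hεpre _ _).1 hzU').2⟩)
      obtain ⟨-, a, ha, hUa⟩ := ZFSet.mem_sep.1 hU'
      exact ⟨a, ha, hAτ ha, U', hU'F, fun z hz hzU =>
        ((hψpre _ _).1 (hUa ((hεpre _ _).2 ⟨hz, hzU⟩))).2⟩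
  refine ⟨_, hFX, ⟨hO, V₀, ?_, fun z hz hzV => (hO_iff z hz).2 hzV⟩, ?_⟩
  · obtain ⟨U, -, -, hUF⟩ := hVUF 0
    exact hF.mono _ hUF _ hV₀ fun x hx => (ZFSet.mem_inter.1 hx).1
  · have hGf := hFX.map hXt hYt hf
    -- Both sides are witnessed by sets of the ultrafilter, so a common `z ∈ Z` exists and `φ (ψ z)`
    -- lies in `P ∩ Q`.
    have hmeet : ∀ P ∈ G, ∀ Q ∈ {P | P ∈ σ ∧
        preimg f X P ∈ {A | A ∈ τ ∧ ∃ U ∈ F, ∀ z ∈ Z, ε z ∈ U → ψ z ∈ A}}, P ∩ Q ≠ ∅ := by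
      rintro P hP Q ⟨hQ, -, U, ⟨-, R, hR, hR𝒰, hRU⟩, hUQ⟩ h0
      obtain ⟨z, ⟨hz, -, hzP⟩, hzR⟩ := 𝒰.nonempty_of_mem
        (Filter.inter_mem (hS𝒰 ⟨0, P, hP⟩) (Ultrafilter.mem_map.1 hR𝒰))
      have hzQ := ((hφpre _ _).1 (hUQ z hz (hRU.subset (hK.subset _ hR) hzR))).2
      exact (ZFSet.eq_empty _).1 h0 _ (ZFSet.mem_inter.2 ⟨hzP, hzQ⟩)
    intro P hP
    constructor
    · intro hPF
      refine hGf.subset_of_meet hYt hYr hG (fun Q hQ P' hP' => ?_) ⟨hP, hPF⟩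
      have := hmeet P' hP' Q hQ
      rwa [show Q ∩ P' = P' ∩ Q from by ext; simp [and_comm]]
    · intro hPG
      exact (hG.subset_of_meet hYt hYr hGf hmeet hPG).2

end Lifting

/-! ### Interpretations as spaces of points over `M`. -/

section Interpretations

variable {M : Set ZFSet.{u}} {X τ : ZFSet.{u}}

/-- The open sets in `τ` whose interpretations contain `x`. -/
def pointFilter {τ : ZFSet.{u}} {Xh : Type u} (πo : τ → Set Xh) (x : Xh) : Set ZFSet.{u} :=
  {O | ∃ h : O ∈ τ, x ∈ πo ⟨O, h⟩}

theorem mem_pointFilter {Xh : Type u} {πo : τ → Set Xh} {x : Xh} (O : τ) :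
    O.1 ∈ pointFilter πo x ↔ x ∈ πo O :=
  ⟨fun ⟨_, h⟩ => h, fun h => ⟨O.2, h⟩⟩

theorem isPoint_principal (hX : IsTopSpaceIn M X τ) {x : ZFSet.{u}} (hx : x ∈ X) :
    IsPoint M X τ {O | O ∈ τ ∧ x ∈ O} where
  isOpen _ h := h.1
  univ := ⟨hX.univ_mem, hx⟩
  empty h := ZFSet.notMem_empty _ h.2
  inter _ hO _ hP := ⟨hX.inter_mem _ hO.1 _ hP.1, ZFSet.mem_inter.2 ⟨hO.2, hP.2⟩⟩
  mono _ hO _ hP hOP := ⟨hP, hOP hO.2⟩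
  prime A _ hAτ h := by
    obtain ⟨P, hP, hxP⟩ := ZFSet.mem_sUnion.1 h.2
    exact ⟨P, hP, hAτ hP, hxP⟩

/-- The points over `M` of `⟨X, τ⟩`. -/
abbrev Points (M : Set ZFSet.{u}) (X τ : ZFSet.{u}) : Type (u + 1) :=
  {G : Set ZFSet.{u} // IsPoint M X τ G}

/-- A point is determined by a subset of `τ`. Smallness lets the space of points compete in the
universal property, which ranges over `Type u`. -/
instance Points.small : Small.{u} (Points M X τ) := by
  refine small_of_injective (f := fun G : Points M X τ => {O : τ | O.1 ∈ G.1}) fun G G' h => ?_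
  ext O
  constructor
  · intro hO
    exact (Set.ext_iff.1 h ⟨O, G.2.isOpen _ hO⟩).1 hO
  · intro hO
    exact (Set.ext_iff.1 h ⟨O, G'.2.isOpen _ hO⟩).2 hO

/-- The open set of points over `M` determined by an element of `τ`. -/
def Points.opens (M : Set ZFSet.{u}) (X τ : ZFSet.{u}) (O : τ) : Set (Shrink.{u} (Points M X τ)) :=
  {q | O.1 ∈ ((equivShrink _).symm q).1}

theorem Points.mem_opens {O : τ} {q : Shrink.{u} (Points M X τ)} :
    q ∈ Points.opens M X τ O ↔ O.1 ∈ ((equivShrink _).symm q).1 :=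
  Iff.rfl

instance Points.topology : TopologicalSpace (Shrink.{u} (Points M X τ)) :=
  TopologicalSpace.generateFrom (Set.range (Points.opens M X τ))

theorem Points.isPreinterpretation (hX : IsTopSpaceIn M X τ) :
    IsPreinterpretation M X τ (Shrink.{u} (Points M X τ))
      (fun x => equivShrink _ ⟨_, isPoint_principal hX x.2⟩) (Points.opens M X τ) := by
  have hpt := fun q : Shrink.{u} (Points M X τ) => ((equivShrink _).symm q).2
  have hinter : ∀ O P Q : τ, Q.1 = O.1 ∩ P.1 →
      Points.opens M X τ Q = Points.opens M X τ O ∩ Points.opens M X τ P := by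
    intro O P Q hQ
    ext q
    simp only [Set.mem_inter_iff, Points.mem_opens]
    constructor
    · intro h
      exact ⟨(hpt q).mono _ h _ O.2 fun x hx => (ZFSet.mem_inter.1 (hQ ▸ hx)).1,
        (hpt q).mono _ h _ P.2 fun x hx => (ZFSet.mem_inter.1 (hQ ▸ hx)).2⟩
    · rintro ⟨h₁, h₂⟩
      exact hQ ▸ (hpt q).inter _ h₁ _ h₂
  have huniv : ∀ O : τ, O.1 = X → Points.opens M X τ O = Set.univ := fun O hO =>
    Set.eq_univ_of_forall fun q => by
      rw [Points.mem_opens, hO]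
      exact (hpt q).univ
  refine ⟨⟨fun q q' h => ?_⟩, fun x O => ?_, hinter, fun A hA hAτ O hO => ?_, fun O hO => ?_, huniv,
    ⟨?_, ?_, rfl⟩⟩
  · refine (equivShrink _).symm.injective (Subtype.ext (Set.ext fun O => ?_))
    have key : ∀ hO : O ∈ τ, q ∈ Points.opens M X τ ⟨O, hO⟩ ↔ q' ∈ Points.opens M X τ ⟨O, hO⟩ :=
      fun hO => h.mem_open_iff (TopologicalSpace.isOpen_generateFrom_of_mem ⟨_, rfl⟩)
    exact ⟨fun hO => (key ((hpt q).isOpen _ hO)).1 hO, fun hO => (key ((hpt q').isOpen _ hO)).2 hO⟩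
  · simp [Points.opens, O.2]
  · ext q
    simp only [Set.mem_iUnion, Points.mem_opens]
    constructor
    · intro h
      obtain ⟨P, hP, hPq⟩ := (hpt q).prime A hA hAτ (hO ▸ h)
      exact ⟨⟨P, hAτ hP⟩, hP, hPq⟩
    · rintro ⟨P, hP, hPq⟩
      exact (hpt q).mono _ hPq _ O.2 fun x hx => hO ▸ ZFSet.mem_sUnion.2 ⟨_, hP, hx⟩
  · refine Set.eq_empty_of_forall_notMem fun q hq => (hpt q).empty ?_
    rwa [Points.mem_opens, hO] at hq
  · rintro - ⟨O, rfl⟩ - ⟨P, rfl⟩ q hq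
    rw [← hinter O P ⟨_, hX.inter_mem _ O.2 _ P.2⟩ rfl] at hq ⊢
    exact ⟨_, ⟨_, rfl⟩, hq, subset_rfl⟩
  · exact Set.eq_univ_of_univ_subset (Set.subset_sUnion_of_mem ⟨⟨X, hX.univ_mem⟩, huniv _ rfl⟩)

variable {Xh : Type u} [TopologicalSpace Xh] {π : X → Xh} {πo : τ → Set Xh}

/-- A reduction of the space of all points sends `G` to a point with trace `G`. The universal
property enters the proof only here. -/
theorem IsInterpretation.exists_point (hX : IsTopSpaceIn M X τ)
    (hπ : IsInterpretation M X τ Xh π πo) {G : Set ZFSet.{u}} (hG : IsPoint M X τ G) :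
    ∃ x, ∀ O : τ, x ∈ πo O ↔ O.1 ∈ G := by
  obtain ⟨h, -, hh⟩ := hπ.2 _ _ _ (Points.isPreinterpretation hX)
  refine ⟨h (equivShrink _ ⟨G, hG⟩), fun O => ?_⟩
  rw [← Set.mem_preimage, hh]
  simp [Points.opens]

theorem IsPreinterpretation.isOpen (hπ : IsPreinterpretation M X τ Xh π πo) (O : τ) :
    IsOpen (πo O) :=
  hπ.isBasis.isOpen ⟨O, rfl⟩

theorem IsPreinterpretation.eq_of_mem_iff (hπ : IsPreinterpretation M X τ Xh π πo) {x y : Xh}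
    (h : ∀ O, x ∈ πo O ↔ y ∈ πo O) : x = y := by
  have := hπ.t0
  refine (hπ.isBasis.inseparable_iff.2 ?_).eq
  rintro - ⟨O, rfl⟩
  exact h O

theorem IsPreinterpretation.isPoint (hX : IsTopSpaceIn M X τ)
    (hπ : IsPreinterpretation M X τ Xh π πo) (x : Xh) : IsPoint M X τ (pointFilter πo x) where
  isOpen _ h := h.1
  univ := ⟨hX.univ_mem, by rw [hπ.univ _ rfl]; trivial⟩
  empty := fun ⟨h, hx⟩ => by rw [hπ.empty _ rfl] at hx; exact hx
  inter := fun O ⟨hO, hxO⟩ P ⟨hP, hxP⟩ => ⟨hX.inter_mem _ hO _ hP, by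
    rw [hπ.inter ⟨O, hO⟩ ⟨P, hP⟩ _ rfl]; exact ⟨hxO, hxP⟩⟩
  mono := fun O ⟨hO, hxO⟩ P hP hOP => ⟨hP, by
    rw [hπ.inter ⟨O, hO⟩ ⟨P, hP⟩ _ (ZFSet.inter_eq_left_of_subset hOP).symm] at hxO
    exact hxO.2⟩
  prime := fun A hA hAτ ⟨hO, hx⟩ => by
    rw [hπ.sUnion A hA hAτ _ rfl] at hx
    simp only [Set.mem_iUnion] at hx
    obtain ⟨P, hP, hxP⟩ := hx
    exact ⟨P.1, hP, P.2, hxP⟩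

theorem IsPreinterpretation.denseRange (hπ : IsPreinterpretation M X τ Xh π πo)
    (hX : IsTopSpaceIn M X τ) : DenseRange π := by
  rw [DenseRange, hπ.isBasis.dense_iff]
  rintro - ⟨O, rfl⟩ hne
  have hO : O.1 ≠ ∅ := fun h => by
    rw [hπ.empty O h] at hne
    exact Set.not_nonempty_empty hne
  obtain ⟨x, hx⟩ := (ZFSet.eq_empty_or_nonempty _).resolve_left hO
  exact ⟨_, (hπ.mem_iff ⟨x, hX.subset _ O.2 hx⟩ O).1 hx, _, rfl⟩

variable [hM : Fact (IsTransitiveModel M)]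

/-- Being well inside is a statement about a finite union and a finite intersection, which
preinterpretations preserve. Regularity therefore transfers, and with T₀ gives Hausdorff. -/
theorem IsPreinterpretation.t2Space (hπ : IsPreinterpretation M X τ Xh π πo)
    (hX : IsTopSpaceIn M X τ) (hr : IsRegular X τ) : T2Space Xh := by
  have := hπ.t0
  have : RegularSpace Xh := by
    refine RegularSpace.of_exists_mem_nhds_isClosed_subset fun x s hs => ?_
    obtain ⟨-, ⟨O, rfl⟩, hxO, hOs⟩ := hπ.isBasis.mem_nhds_iff.1 hs
    have hx := hπ.isPoint hX x
    obtain ⟨P, ⟨hP, hxP⟩, Q, hQ, h₁, h₂⟩ := hx.exists_wellInside hX hr ((mem_pointFilter O).2 hxO)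
    refine ⟨(πo ⟨Q, hQ⟩)ᶜ, Filter.mem_of_superset ((hπ.isOpen ⟨P, hP⟩).mem_nhds hxP) fun y hyP hyQ =>
      ?_, (hπ.isOpen _).isClosed_compl, fun y hyQ => hOs ?_⟩
    · have hy := (hπ.isPoint hX y).inter P ⟨hP, hyP⟩ Q ⟨hQ, hyQ⟩
      exact (hπ.isPoint hX y).empty (h₂ ▸ hy)
    · have hy := hπ.isPoint hX y
      refine (mem_pointFilter O).1 ((hy.union hX O.2 hQ (h₁ ▸ hy.univ)).resolve_right ?_)
      exact fun ⟨_, h⟩ => hyQ h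
  infer_instance

end Interpretations

end ModelTop

/-! ### The open mapping theorem. -/

theorem mainTheorem6 (M : Set ZFSet.{u}) (hM : ModelTop.IsTransitiveModel M)
    (X τ Y σ f : ZFSet.{u})
    (hX : ModelTop.IsInterpretableIn M X τ) (hY : ModelTop.IsInterpretableIn M Y σ)
    (hf : ModelTop.IsContinuousIn M X τ Y σ f) (hfo : ModelTop.IsOpenFun τ Y σ f)
    (Xh Yh : Type u) [TopologicalSpace Xh] [TopologicalSpace Yh]
    (π : X → Xh) (πo : τ → Set Xh) (χ : Y → Yh) (χo : σ → Set Yh)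
    (hπ : ModelTop.IsInterpretation M X τ Xh π πo)
    (hχ : ModelTop.IsInterpretation M Y σ Yh χ χo) :
    ∃ fh : Xh → Yh,
      (ModelTop.IsMapInterpretation f π χ fh ∧
        ∀ gh : Xh → Yh, ModelTop.IsMapInterpretation f π χ gh → gh = fh) ∧
      Continuous fh ∧ IsOpenMap fh ∧
      (∀ (O : τ) (P : σ), ModelTop.img f O.1 Y = P.1 → fh '' πo O = χo P) ∧
      (ModelTop.IsOnto X Y f → Function.Surjective fh) := by
  have : Fact (ModelTop.IsTransitiveModel M) := ⟨hM⟩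
  obtain ⟨φ, hφ, hφf, hpre, himg⟩ := ModelTop.exists_fun_of_isFunc hf.isFunc
  have hπp := hπ.1.isPoint hX.1
  have hχp := hχ.1.isPoint hY.1
  choose fh hfh using fun x => hχ.exists_point hY.1 ((hπp x).map hX.1 hY.1 hf)
  have hfh' : ∀ x (P : σ), fh x ∈ χo P ↔ x ∈ πo ⟨_, hf.preimg_mem _ P.2⟩ := fun x P => by
    rw [hfh, ← ModelTop.mem_pointFilter]
    exact and_iff_right P.2
  have hcont : Continuous fh := by
    refine hχ.1.isBasis.continuous_iff.2 ?_
    rintro - ⟨P, rfl⟩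
    rw [show fh ⁻¹' χo P = πo ⟨_, hf.preimg_mem _ P.2⟩ from Set.ext fun x => hfh' x P]
    exact hπ.1.isOpen _
  have hint : ModelTop.IsMapInterpretation f π χ fh := by
    refine ⟨hcont, fun x y hxy => hχ.1.eq_of_mem_iff fun P => ?_⟩
    rw [hfh', ← hπ.1.mem_iff, ← hχ.1.mem_iff, hpre, and_iff_right x.2, (hφf x.1 x.2 _).1 hxy]
  have himage : ∀ (O : τ) (P : σ), ModelTop.img f O.1 Y = P.1 → fh '' πo O = χo P := by
    intro O P hOP
    ext y
    constructor
    · rintro ⟨x, hx, rfl⟩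
      rw [hfh', ← ModelTop.mem_pointFilter]
      refine (hπp x).mono _ ((ModelTop.mem_pointFilter O).2 hx) _ (hf.preimg_mem _ P.2)
        fun z hz => (hpre _ _).2 ⟨hX.1.subset _ O.2 hz, ?_⟩
      rw [← hOP, himg _ _ (hX.1.subset _ O.2)]
      exact ⟨z, hz, rfl⟩
    · intro hy
      -- The trace of `y` lifts to a point of `X` containing `O`, which is realized in `Xh`; T₀
      -- identifies its image with `y`.
      obtain ⟨F, hF, hOF, hFy⟩ := (hχp y).exists_lift hX hY hf hfo O.2
        (hOP ▸ (ModelTop.mem_pointFilter P).2 hy)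
      obtain ⟨x, hx⟩ := hπ.exists_point hX.1 hF
      refine ⟨x, (hx O).2 hOF, hχ.1.eq_of_mem_iff fun Q => ?_⟩
      rw [hfh', hx, hFy _ Q.2, ModelTop.mem_pointFilter]
  refine ⟨fh, ⟨hint, fun gh hgh => ?_⟩, hcont, ?_, himage, fun honto => ?_⟩
  · have := hχ.1.t2Space hY.1 hY.2.2.1
    refine hπ.1.denseRange hX.1 |>.equalizer hgh.1 hcont (funext fun x => ?_)
    have hxy := (hφf x.1 x.2 _).2 rfl
    exact (hgh.2 x ⟨_, hφ _ x.2⟩ hxy).trans (hint.2 x ⟨_, hφ _ x.2⟩ hxy).symm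
  · refine hπ.1.isBasis.isOpenMap_iff.2 ?_
    rintro - ⟨O, rfl⟩
    rw [himage O ⟨_, hfo _ O.2⟩ rfl]
    exact hχ.1.isOpen _
  · have h := himage ⟨X, hX.1.univ_mem⟩ ⟨Y, hY.1.univ_mem⟩ (by
      ext y
      rw [himg y X fun _ h => h]
      constructor
      · rintro ⟨x, hx, rfl⟩
        exact hφ x hx
      · intro hy
        obtain ⟨x, hx, hxy⟩ := honto y hy
        exact ⟨x, hx, ((hφf x hx y).1 hxy).symm⟩)
    rw [hπ.1.univ _ rfl, hχ.1.univ _ rfl] at h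
    exact Set.image_univ.symm.trans h |> Set.range_eq_univ.1
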